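/- All graphs are finite, undirected and simple. A graph is \emph{chordal} if every cycle of length larger than three has a chord, i.e. an edge between two non-consecutive vertices of the cycle. A \emph{chain graph} is a bipartite graph having a bipartition $A\uplus B$ such that the neighbourhoods $N(a)$, $a\in A$, are linearly ordered by inclusion; a \emph{co-chain graph} is the complement of a chain graph. The \emph{vertex deletion problem from chordal graphs to co-chain graphs} asks, given a chordal graph $G$, for a set $V_-\subseteq V(G)$ of minimum cardinality such that $G-V_-$ is a co-chain graph. In its decision version one is given a chordal graph $G$ and an integer $k\ge 0$ (in binary), and has to decide whether some set of at most $k$ vertices can be deleted from $G$ so that a co-chain graph remains. \textbf{Theorem.} The vertex deletion problem from chordal graphs to co-chain graphs is in P: there is a deterministic polynomial-time Turing machine that, given the adjacency matrix of any chordal graph $G$, outputs a minimum set $V_-\subseteq V(G)$ such that $G-V_-$ is a co-chain graph; and there is a deterministic polynomial-time Turing machine that decides the decision version on all inputs consisting of a chordal graph $G$ and an integer $k\ge 0$. -/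

import Mathlib

namespace VertexDeletion

/-- Finite simple graphs, with vertex set `{0, …, n-1}` as in a machine's input. -/
abbrev FinGraph : Type := Σ n : ℕ, SimpleGraph (Fin n)

/-- A class of graphs. -/
abbrev GraphClass : Type 1 := ∀ V : Type, SimpleGraph V → Prop

/-- Chordal graphs: every cycle of length larger than three has a chord, an edge of the graph
between two vertices of the cycle that is not an edge of the cycle. -/
def chordal : GraphClass := fun _ G =>
  ∀ (v : _) (c : G.Walk v v), c.IsCycle → 3 < c.length → ∃ e, c.IsChord e

/-- Chain graphs: bipartite graphs with a bipartition `A ⊎ B` such that the neighbourhoods of the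
vertices in `A` are linearly ordered by inclusion. -/
def chain : GraphClass := fun _ G =>
  ∃ A B : Set _, A ∪ B = Set.univ ∧ G.IsBipartiteWith A B ∧
    IsChain (· ⊆ ·) (G.neighborSet '' A)

/-- The class of the complements of the graphs of a class. -/
def complementClass (C : GraphClass) : GraphClass := fun V G => C V Gᶜ

/-- Co-chain graphs: complements of chain graphs. -/
def coChain : GraphClass := complementClass chain

/-- Deleting the vertex set `X` from `G` leaves a graph of the class `C`. -/
def IsDeletionSet (C : GraphClass) {V : Type} (G : SimpleGraph V) (X : Finset V) : Prop :=
  C _ (G.induce ((X : Set V)ᶜ))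

/-- `X` is a solution of minimum cardinality of the vertex deletion problem to `C` on `G`. -/
def IsMinimumDeletionSet (C : GraphClass) {V : Type} (G : SimpleGraph V) (X : Finset V) : Prop :=
  IsDeletionSet C G X ∧ ∀ Y : Finset V, IsDeletionSet C G Y → X.card ≤ Y.card

/-- The input graphs of a vertex deletion problem with source class `C`. -/
abbrev Source (C : GraphClass) : Type := {G : FinGraph // C (Fin G.1) G.2}

open scoped Classical in
/-- The adjacency matrix, row by row; `none` marks the beginning of each row. -/
noncomputable def encodeGraph (G : FinGraph) : List (Option Bool) :=
  (List.finRange G.1).flatMap fun i =>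
    none :: (List.finRange G.1).map fun j => some (decide (G.2.Adj i j))

/-- A vertex subset of an `n`-vertex graph, as a string of `n` bits. -/
def encodeVertexSet (X : Σ n : ℕ, Finset (Fin n)) : List Bool :=
  (List.finRange X.1).map fun v => decide (v ∈ X.2)

/-- A graph followed by a natural number in binary. -/
noncomputable def encodeGraphNat (p : FinGraph × ℕ) : List (Option Bool ⊕ Bool) :=
  (encodeGraph p.1).map Sum.inl ++ (Computability.encodeNat p.2).map Sum.inr

/-- The vertex deletion problem from `C₁` to `C₂`: some polynomial-time Turing machine outputs,
for every graph of `C₁`, a minimum set of vertices whose deletion leaves a graph of `C₂`. -/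
def SolvableInPolyTime (C₁ C₂ : GraphClass) : Prop :=
  ∃ f : (G : Source C₁) → Finset (Fin G.1.1),
    (∀ G, IsMinimumDeletionSet C₂ G.1.2 (f G)) ∧
    Nonempty (Turing.TM2ComputableInPolyTime (fun G : Source C₁ => encodeGraph G.1)
      encodeVertexSet (fun G => ⟨G.1.1, f G⟩))

open scoped Classical in
/-- The decision version: some polynomial-time Turing machine decides, for every graph of `C₁`
and every `k`, whether deleting at most `k` vertices can leave a graph of `C₂`. -/
def DecidableInPolyTime (C₁ C₂ : GraphClass) : Prop :=
  Nonempty (Turing.TM2ComputableInPolyTime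
    (fun p : Source C₁ × ℕ => encodeGraphNat (p.1.1, p.2)) Computability.encodeBool
    (fun p => decide (∃ X : Finset (Fin p.1.1.1), X.card ≤ p.2 ∧ IsDeletionSet C₂ p.1.1.2 X)))

/-- The vertex deletion problem from `C₁` to `C₂` is in P. -/
def InP (C₁ C₂ : GraphClass) : Prop :=
  SolvableInPolyTime C₁ C₂ ∧ DecidableInPolyTime C₁ C₂

end VertexDeletion

/-! In a chordal graph, deleting `X` leaves a co-chain graph exactly when two cliques cover the
remaining vertices (`isDeletionSet_coChain_iff`). The two sides of a bipartition of the complement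
are cliques of `G`; conversely, if two cliques cover the rest, incomparable neighbourhoods in the
complement would give an induced four-cycle of `G`. So the task is to find two cliques with the
largest possible union, and enlarging a clique never hurts.

Few cliques have to be considered. By Dirac's theorem (`exists_simplicialIn`) every nonempty vertex
set contains a vertex that is simplicial in it, so the vertices can be eliminated one by one, each
recording its closed neighbourhood among the vertices still present. The `n` recorded sets are
cliques, and every nonempty clique lies in the set recorded by its first eliminated member
(`eliminated_spec`). Trying all pairs of recorded cliques therefore finds an optimum
(`isMinimumDeletionSet_solutionSet`).

The passage to Turing machines has two layers. Structured stack programs (`Prog`) are turned into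
machines, and `Runs` is a compositional judgement that counts machine steps. Loop programs (`Cmd`),
with loops over `0, …, n - 1` and `n × n` bit arrays, are simulated by stack programs
(`runs_toProg`); every loop has exactly `n` rounds, so the running time is a polynomial in `n` read
off from the syntax. The algorithm is the loop program `solve`, whose effect is computed in
`eval_solve`. For the decision version, the size of the optimum, in unary, is compared with the
binary `k` digit by digit (`reduce_eq_zero_iff`). -/

namespace StackProgram

/-! ### Structured stack programs and their Turing machines. -/

open Turing

/-- The input symbols a program distinguishes. -/
abbrev Sym : Type := Option Bool ⊕ Bool

/-- The register of a program: the symbol popped last, or `none` if the stack was empty. -/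
abbrev Reg : Type := Option Sym

/-- Structured programs acting on an input stack, on stacks of bits indexed by `κ`, and on a
register. -/
inductive Prog (κ : Type) : Type
  | nop : Prog κ
  | push (k : κ) (f : Reg → Bool) : Prog κ
  | pop (k : κ) : Prog κ
  | read : Prog κ
  | seq (p q : Prog κ) : Prog κ
  | ite (b : Reg → Bool) (p q : Prog κ) : Prog κ
  | loop (b : Reg → Bool) (p : Prog κ) : Prog κ

/-- The stack alphabets: `I` for the input stack, bits for the others. -/
@[reducible] def Alphabet (κ I : Type) : Option κ → Type
  | none => I
  | some _ => Bool

/-- The states of a program run. -/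
structure State (κ I : Type) where
  /-- the symbol popped last -/
  reg : Reg
  /-- the input stack -/
  inp : List I
  /-- the stacks of bits -/
  stk : κ → List Bool

variable {κ I : Type}

/-- All the stacks of a state as a single family. -/
def State.stacks (s : State κ I) : ∀ k, List (Alphabet κ I k)
  | none => s.inp
  | some k => s.stk k

namespace Prog

/-- The machine labels of a program. -/
def Label : Prog κ → Type
  | nop => Unit
  | push _ _ => Unit
  | pop _ => Unit
  | read => Unit
  | seq p q => p.Label ⊕ q.Label
  | ite _ p q => Option (p.Label ⊕ q.Label)
  | loop _ p => Option p.Label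

/-- The label at which a program starts. -/
def entry : (p : Prog κ) → p.Label
  | nop => ()
  | push _ _ => ()
  | pop _ => ()
  | read => ()
  | seq p _ => Sum.inl p.entry
  | ite _ _ _ => none
  | loop _ _ => none

/-- The finitely many labels of a program. -/
@[reducible] def labelFintype : (p : Prog κ) → Fintype p.Label
  | nop => inferInstanceAs (Fintype Unit)
  | push _ _ => inferInstanceAs (Fintype Unit)
  | pop _ => inferInstanceAs (Fintype Unit)
  | read => inferInstanceAs (Fintype Unit)
  | seq p q =>
    letI := p.labelFintype; letI := q.labelFintype
    inferInstanceAs (Fintype (p.Label ⊕ q.Label))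
  | ite _ p q =>
    letI := p.labelFintype; letI := q.labelFintype
    inferInstanceAs (Fintype (Option (p.Label ⊕ q.Label)))
  | loop _ p =>
    letI := p.labelFintype
    inferInstanceAs (Fintype (Option p.Label))

/-- The machine code of a program whose labels are embedded by `ι` and which continues at
`exit`. -/
def code (d : I → Sym) : (p : Prog κ) → {Λ : Type} → (p.Label → Λ) → Λ → p.Label →
    TM2.Stmt (Alphabet κ I) Λ Reg
  | nop, _, _, exit, _ => .goto fun _ => exit
  | push k f, _, _, exit, _ => .push (some k) f (.goto fun _ => exit)
  | pop k, _, _, exit, _ => .pop (some k) (fun _ b => b.map Sum.inr) (.goto fun _ => exit)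
  | read, _, _, exit, _ => .pop none (fun _ b => b.map d) (.goto fun _ => exit)
  | seq p q, _, ι, _, Sum.inl l => p.code d (ι ∘ Sum.inl) (ι (Sum.inr q.entry)) l
  | seq _ q, _, ι, exit, Sum.inr l => q.code d (ι ∘ Sum.inr) exit l
  | ite b p q, _, ι, _, none =>
    .branch b (.goto fun _ => ι (some (Sum.inl p.entry))) (.goto fun _ => ι (some (Sum.inr q.entry)))
  | ite _ p _, _, ι, exit, some (Sum.inl l) => p.code d (ι ∘ some ∘ Sum.inl) exit l
  | ite _ _ q, _, ι, exit, some (Sum.inr l) => q.code d (ι ∘ some ∘ Sum.inr) exit l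
  | loop b p, _, ι, exit, none => .branch b (.goto fun _ => ι (some p.entry)) (.goto fun _ => exit)
  | loop _ p, _, ι, _, some l => p.code d (ι ∘ some) (ι none) l

variable [DecidableEq κ]

/-- The program `p` leads from state `s` to state `s'` in at most `T` machine steps. -/
def Runs (d : I → Sym) (p : Prog κ) (s s' : State κ I) (T : ℕ) : Prop :=
  ∀ (Λ : Type) (ι : p.Label → Λ) (exit : Λ) (M : Λ → TM2.Stmt (Alphabet κ I) Λ Reg),
    (∀ l, M (ι l) = p.code d ι exit l) →
    ∃ t ≤ T, (flip bind (TM2.step M))^[t] (some ⟨some (ι p.entry), s.reg, s.stacks⟩) =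
      some ⟨some exit, s'.reg, s'.stacks⟩

variable {d : I → Sym} {p q : Prog κ} {s s₁ s₂ : State κ I} {T T₁ T₂ : ℕ}

theorem update_stacks_some (r r' : Reg) (i : List I) (S : κ → List Bool) (k : κ) (l : List Bool) :
    Function.update (State.stacks ⟨r, i, S⟩) (some k) l =
      State.stacks ⟨r', i, Function.update S k l⟩ := by
  funext j
  cases j with
  | none => simp [State.stacks]
  | some j =>
    by_cases h : j = k
    · subst h; simp [State.stacks]
    · simp [State.stacks, h]

theorem update_stacks_none (r r' : Reg) (i i' : List I) (S : κ → List Bool) :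
    Function.update (State.stacks ⟨r, i, S⟩) none i' = State.stacks ⟨r', i', S⟩ := by
  funext j
  cases j <;> simp [State.stacks]

theorem Runs.mono (h : Runs d p s s₁ T₁) (hT : T₁ ≤ T₂) : Runs d p s s₁ T₂ := by
  intro Λ ι exit M hM
  obtain ⟨t, ht, e⟩ := h Λ ι exit M hM
  exact ⟨t, ht.trans hT, e⟩

theorem runs_nop : Runs d nop s s 1 := by
  intro Λ ι exit M hM
  refine ⟨1, le_rfl, ?_⟩
  simp [flip, hM, code]

theorem runs_push (k : κ) (f : Reg → Bool) (r : Reg) (i : List I) (S : κ → List Bool) :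
    Runs d (push k f) ⟨r, i, S⟩ ⟨r, i, Function.update S k (f r :: S k)⟩ 1 := by
  intro Λ ι exit M hM
  refine ⟨1, le_rfl, ?_⟩
  simp only [Function.iterate_one, flip, Option.bind_eq_bind, Option.bind_some, TM2.step, hM, code,
    TM2.stepAux]
  exact congrArg some (congrArg _ (update_stacks_some _ _ _ _ _ _))

theorem runs_pop (k : κ) (r : Reg) (i : List I) (S : κ → List Bool) :
    Runs d (pop k) ⟨r, i, S⟩
      ⟨(S k).head?.map Sum.inr, i, Function.update S k (S k).tail⟩ 1 := by
  intro Λ ι exit M hM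
  refine ⟨1, le_rfl, ?_⟩
  simp only [Function.iterate_one, flip, Option.bind_eq_bind, Option.bind_some, TM2.step, hM, code,
    TM2.stepAux]
  exact congrArg some (congrArg _ (update_stacks_some _ _ _ _ _ _))

theorem runs_read (r : Reg) (i : List I) (S : κ → List Bool) :
    Runs d read ⟨r, i, S⟩ ⟨i.head?.map d, i.tail, S⟩ 1 := by
  intro Λ ι exit M hM
  refine ⟨1, le_rfl, ?_⟩
  simp only [Function.iterate_one, flip, Option.bind_eq_bind, Option.bind_some, TM2.step, hM, code,
    TM2.stepAux]
  exact congrArg some (congrArg _ (update_stacks_none _ _ _ _ _))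

/-- Composition works because `Runs` quantifies over all host machines containing the code: the
machine of `seq p q` hosts `p`, with the entry of `q` as its exit, and also hosts `q`. -/
theorem Runs.seq (hp : Runs d p s s₁ T₁) (hq : Runs d q s₁ s₂ T₂) :
    Runs d (p.seq q) s s₂ (T₁ + T₂) := by
  intro Λ ι exit M hM
  obtain ⟨t₁, h₁, e₁⟩ := hp Λ (ι ∘ Sum.inl) (ι (Sum.inr q.entry)) M (fun l => hM (Sum.inl l))
  obtain ⟨t₂, h₂, e₂⟩ := hq Λ (ι ∘ Sum.inr) exit M (fun l => hM (Sum.inr l))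
  refine ⟨t₂ + t₁, by omega, ?_⟩
  rw [Function.iterate_add_apply]
  exact (congrArg _ e₁).trans e₂

theorem Runs.ite_true {b : Reg → Bool} (h : Runs d p s s₁ T) (hb : b s.reg = true) :
    Runs d (ite b p q) s s₁ (T + 1) := by
  intro Λ ι exit M hM
  obtain ⟨t, ht, e⟩ := h Λ (ι ∘ some ∘ Sum.inl) exit M (fun l => hM (some (Sum.inl l)))
  refine ⟨t + 1, by omega, ?_⟩
  rw [Function.iterate_succ_apply]
  refine (congrArg _ ?_).trans e
  change some (TM2.stepAux (M (ι (Prog.ite b p q).entry)) s.reg s.stacks) = _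
  rw [hM]
  simp [code, entry, hb]
  rfl

theorem Runs.ite_false {b : Reg → Bool} (h : Runs d q s s₁ T) (hb : b s.reg = false) :
    Runs d (ite b p q) s s₁ (T + 1) := by
  intro Λ ι exit M hM
  obtain ⟨t, ht, e⟩ := h Λ (ι ∘ some ∘ Sum.inr) exit M (fun l => hM (some (Sum.inr l)))
  refine ⟨t + 1, by omega, ?_⟩
  rw [Function.iterate_succ_apply]
  refine (congrArg _ ?_).trans e
  change some (TM2.stepAux (M (ι (Prog.ite b p q).entry)) s.reg s.stacks) = _
  rw [hM]
  simp [code, entry, hb]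
  rfl

theorem runs_loop_false {b : Reg → Bool} (hb : b s.reg = false) : Runs d (loop b p) s s 1 := by
  intro Λ ι exit M hM
  refine ⟨1, le_rfl, ?_⟩
  change some (TM2.stepAux (M (ι (Prog.loop b p).entry)) s.reg s.stacks) = _
  rw [hM]
  simp [code, entry, hb]

/-- The body exits to the label of the test, so one round is followed by a run of the same loop; the
branch costs the extra step. -/
theorem Runs.loop_true {b : Reg → Bool} (hb : b s.reg = true) (hp : Runs d p s s₁ T₁)
    (h : Runs d (loop b p) s₁ s₂ T₂) : Runs d (loop b p) s s₂ (T₁ + T₂ + 1) := by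
  intro Λ ι exit M hM
  obtain ⟨t₁, h₁, e₁⟩ := hp Λ (ι ∘ some) (ι none) M (fun l => hM (some l))
  obtain ⟨t₂, h₂, e₂⟩ := h Λ ι exit M hM
  refine ⟨t₂ + (t₁ + 1), by omega, ?_⟩
  rw [Function.iterate_add_apply, Function.iterate_succ_apply]
  refine (congrArg _ ((congrArg _ ?_).trans e₁)).trans e₂
  change some (TM2.stepAux (M (ι (Prog.loop b p).entry)) s.reg s.stacks) = _
  rw [hM]
  simp [code, entry, hb]
  rfl

/-- The Turing machine of a program, with the stack `out` for its output. -/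
def machine [Fintype κ] [Fintype I] (d : I → Sym) (p : Prog κ) (out : κ) : FinTM2 where
  K := Option κ
  k₀ := none
  k₁ := some out
  Γ := Alphabet κ I
  Λ := Option p.Label
  main := some p.entry
  ΛFin := letI := p.labelFintype; inferInstance
  σ := Reg
  initialState := none
  Γk₀Fin := inferInstanceAs (Fintype I)
  m
    | none => .load (fun _ => none) .halt
    | some l => p.code d some none l

/-- A program that leaves its output `w` on the stack `out` and empties all other stacks gives a
machine with output `w`. -/
theorem Runs.outputs [Fintype κ] [Fintype I] {out : κ} {i i' : List I} {w : List Bool} {r : Reg}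
    {S : κ → List Bool} (hi : i' = []) (hS : S = Function.update (fun _ => []) out w)
    (h : Runs d p ⟨none, i, fun _ => []⟩ ⟨r, i', S⟩ T) :
    Nonempty (TM2OutputsInTime (machine d p out) i (some w) (T + 1)) := by
  obtain ⟨t, ht, e⟩ := h _ some none (machine d p out).m (fun l => rfl)
  subst hi hS
  -- The extra step executes the label `none`, which resets the register, since `haltList` demands
  -- its initial value, and halts.
  refine ⟨⟨⟨t + 1, ?_⟩, Nat.succ_le_succ ht⟩⟩
  have h₀ : initList (machine d p out) i =
      ⟨some (some p.entry), none, State.stacks ⟨none, i, fun _ => []⟩⟩ := by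
    unfold initList
    congr 1
    funext k
    cases k with
    | none => rfl
    | some k => rfl
  have h₁ : haltList (machine d p out) w =
      ⟨none, none, State.stacks ⟨r, ([] : List I), Function.update (fun _ => []) out w⟩⟩ := by
    unfold haltList
    congr 1
    funext k
    cases k with
    | none => rfl
    | some k =>
      by_cases hk : k = out
      · subst hk
        simp [machine, State.stacks]
        rfl
      · have : ¬ (some k = some out) := by simpa using hk
        simp only [machine, State.stacks, Function.update_of_ne hk]
        exact dif_neg this
  rw [Function.iterate_succ_apply', h₀]
  refine (congrArg _ e).trans ?_
  refine Eq.trans ?_ (congrArg some h₁.symm)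
  rfl

end Prog
end StackProgram

/-! ### Basic stack routines: draining, moving, clearing, unary addition. -/

namespace StackProgram
namespace Prog

open Function (update)

variable {κ I : Type} [DecidableEq κ] {d : I → Sym} {p q : Prog κ} {r r' : Reg} {i i' : List I}
  {S S' S₁ S₂ : κ → List Bool} {T T₁ T₂ : ℕ}

theorem Runs.of_eq (h : Runs d p ⟨r, i, S⟩ ⟨r', i', S'⟩ T) (h₁ : S = S₁) (h₂ : S' = S₂) :
    Runs d p ⟨r, i, S₁⟩ ⟨r', i', S₂⟩ T :=
  h₁ ▸ h₂ ▸ h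

/-- Pop the stack `k` until it is empty, each time followed by `p`. -/
def drain (k : κ) (p : Prog κ) : Prog κ :=
  seq (pop k) (loop Option.isSome (seq p (pop k)))

/-- `F j` is the loop invariant, the contents of the stacks after `j` rounds. A round costs `T`
steps for `p`, one for the test and one for the next pop; the final 2 are the first pop and the
failing test. -/
theorem runs_drain {k : κ} (L : List Bool) (F : ℕ → κ → List Bool)
    (hF : ∀ j ≤ L.length, F j k = L.drop j)
    (hp : ∀ j (h : j < L.length), ∃ r', Runs d p
      ⟨some (Sum.inr L[j]), i, update (F j) k (L.drop (j + 1))⟩ ⟨r', i, F (j + 1)⟩ T)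
    (r : Reg) :
    Runs d (drain k p) ⟨r, i, F 0⟩ ⟨none, i, F L.length⟩ ((T + 2) * L.length + 2) := by
  have key : ∀ m j, j + m = L.length →
      Runs d (loop Option.isSome (seq p (pop k)))
        ⟨(L.drop j).head?.map Sum.inr, i, update (F j) k (L.drop j).tail⟩
        ⟨none, i, F L.length⟩ ((T + 2) * m + 1) := by
    intro m
    induction m with
    | zero =>
      intro j hj
      obtain rfl : j = L.length := by omega
      have : update (F L.length) k [] = F L.length := by
        rw [Function.update_eq_self_iff, hF _ le_rfl, List.drop_length]
      simpa [this] using runs_loop_false (s := ⟨none, i, F L.length⟩) rfl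
    | succ m ih =>
      intro j hj
      have hlt : j < L.length := by omega
      obtain ⟨r', h⟩ := hp j hlt
      have h₂ := runs_pop (d := d) k r' i (F (j + 1))
      rw [hF _ hlt] at h₂
      have h₃ := Runs.loop_true (b := Option.isSome) (by rfl) (h.seq h₂) (ih (j + 1) (by omega))
      rw [List.drop_eq_getElem_cons hlt]
      exact h₃.mono (by ring_nf; omega)
  have h₁ := runs_pop (d := d) k r i (F 0)
  rw [hF 0 (Nat.zero_le _)] at h₁
  exact (h₁.seq (key L.length 0 (by omega))).mono (by omega)

/-- The bit in the register. -/
def bit (r : Reg) : Bool := decide (r = some (Sum.inr true))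

@[simp] theorem bit_some_inr (b : Bool) : bit (some (Sum.inr b)) = b := by
  cases b <;> simp [bit]

/-- Move the stack `a` onto the stack `b`, reversing it. -/
def move (a b : κ) : Prog κ := drain a (push b bit)

theorem runs_move {a b : κ} (hab : a ≠ b) (r : Reg) (i : List I) (S : κ → List Bool) :
    Runs d (move a b) ⟨r, i, S⟩
      ⟨none, i, update (update S a []) b ((S a).reverse ++ S b)⟩ (3 * (S a).length + 2) := by
  refine (runs_drain (d := d) (k := a) (p := push b bit) (i := i) (T := 1) (S a)
    (fun j => update (update S a ((S a).drop j)) b (((S a).take j).reverse ++ S b)) ?_ ?_ r).of_eq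
    ?_ ?_
  · intro j hj
    simp [hab]
  · intro j hj
    refine ⟨_, (runs_push b bit _ i _).of_eq rfl ?_⟩
    have e : ((S a).take (j + 1)).reverse = (S a)[j] :: ((S a).take j).reverse := by
      rw [List.take_succ_eq_append_getElem hj]
      simp
    rw [bit_some_inr]
    funext c
    simp only [Function.update_apply, e]
    clear e
    split_ifs <;> simp_all
  · simp
  · simp

/-- Empty the stack `a`. -/
def clear (a : κ) : Prog κ := drain a nop

theorem runs_clear (a : κ) (r : Reg) (i : List I) (S : κ → List Bool) :
    Runs d (clear a) ⟨r, i, S⟩ ⟨none, i, update S a []⟩ (3 * (S a).length + 2) := by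
  refine (runs_drain (d := d) (k := a) (p := nop) (i := i) (T := 1) (S a)
    (fun j => update S a ((S a).drop j)) ?_ ?_ r).of_eq ?_ ?_
  · intro j hj
    simp
  · intro j hj
    exact ⟨_, runs_nop.of_eq (by simp) rfl⟩
  · simp
  · simp

/-- Push as many bits onto `b` as there are on the stack `a`, using the empty stack `t`. -/
def addTo (a t b : κ) : Prog κ :=
  seq (drain a (push t fun _ => true)) (drain t (seq (push a fun _ => true) (push b fun _ => true)))

/-- Stacks are read destructively, so the ones of `a` are parked on `t` (3 steps per bit) and then
returned while being copied to `b` (4 steps per bit). -/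
theorem runs_addTo {a t b : κ} (hat : a ≠ t) (hab : a ≠ b) (htb : t ≠ b) {m : ℕ}
    (ha : S a = List.replicate m true) (ht : S t = []) (r : Reg) (i : List I) :
    Runs d (addTo a t b) ⟨r, i, S⟩ ⟨none, i, update S b (List.replicate m true ++ S b)⟩
      (7 * m + 4) := by
  have h₁ : Runs d (drain a (push t fun _ => true)) ⟨r, i, S⟩
      ⟨none, i, update (update S a []) t (List.replicate m true)⟩ (3 * m + 2) := by
    refine ((runs_drain (d := d) (k := a) (p := push t fun _ => true) (i := i) (T := 1)
      (List.replicate m true) (fun j => update (update S a (List.replicate (m - j) true)) t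
        (List.replicate j true)) ?_ ?_ r).of_eq ?_ ?_).mono (by simp)
    · intro j hj
      simp [hat]
    · intro j hj
      refine ⟨_, (runs_push t _ _ i _).of_eq rfl ?_⟩
      funext c
      simp only [Function.update_apply]
      split_ifs <;> simp_all [List.replicate_succ]
    · funext c
      simp only [Function.update_apply]
      split_ifs <;> simp_all
    · simp
  have h₂ : Runs d (drain t (seq (push a fun _ => true) (push b fun _ => true)))
      ⟨none, i, update (update S a []) t (List.replicate m true)⟩
      ⟨none, i, update S b (List.replicate m true ++ S b)⟩ (4 * m + 2) := by
    refine ((runs_drain (d := d) (k := t)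
      (p := seq (push a fun _ => true) (push b fun _ => true)) (i := i) (T := 2)
      (List.replicate m true) (fun j => update (update (update S t (List.replicate (m - j) true)) a
        (List.replicate j true)) b (List.replicate j true ++ S b)) ?_ ?_ none).of_eq ?_ ?_).mono
        (by simp)
    · intro j hj
      simp [hat.symm, htb]
    · intro j hj
      refine ⟨_, ((runs_push a _ _ i _).seq (runs_push b _ _ i _)).of_eq rfl ?_⟩
      funext c
      simp only [Function.update_apply]
      split_ifs <;> simp_all [List.replicate_succ]
    · funext c
      simp only [Function.update_apply]
      split_ifs <;> simp_all
    · funext c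
      simp only [Function.update_apply]
      split_ifs <;> simp_all
  exact (h₁.seq h₂).mono (by omega)

/-- Clear all stacks in a list. -/
def clearAll : List κ → Prog κ
  | [] => nop
  | a :: l => seq (clear a) (clearAll l)

theorem runs_clearAll (l : List κ) (r : Reg) (i : List I) (S : κ → List Bool) :
    ∃ r', Runs d (clearAll l) ⟨r, i, S⟩ ⟨r', i, fun c => if c ∈ l then [] else S c⟩
      (3 * (l.map fun a => (S a).length).sum + 2 * l.length + 1) := by
  induction l generalizing r S with
  | nil => exact ⟨r, (runs_nop.of_eq rfl (by simp)).mono (by simp)⟩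
  | cons a l ih =>
    obtain ⟨r', h⟩ := ih none (update S a [])
    refine ⟨r', (((runs_clear a r i S).seq h).of_eq rfl ?_).mono ?_⟩
    · funext c
      simp only [Function.update_apply, List.mem_cons]
      split_ifs <;> simp_all
    · have : (l.map fun c => (update S a [] c).length).sum ≤ (l.map fun c => (S c).length).sum := by
        refine List.sum_le_sum fun c _ => ?_
        simp only [Function.update_apply]
        split_ifs <;> simp
      simp only [List.map_cons, List.sum_cons, List.length_cons]
      omega

end Prog
end StackProgram

/-! ### Loop programs: their memory, its representation on stacks, and array access. -/

namespace StackProgram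

open Function (update)

/-- The stacks of a loop program: the size `n` in unary, a pair of stacks for each loop index,
arrays of `n * n` bits, buffers, and scratch space. -/
inductive Cell (X Y Z : Type) : Type
  | size : Cell X Y Z
  | idx (x : X) : Cell X Y Z
  | cnt (x : X) : Cell X Y Z
  | arr (a : Y) : Cell X Y Z
  | buf (z : Z) : Cell X Y Z
  | tmp (i : Fin 3) : Cell X Y Z
  deriving DecidableEq, Fintype

/-- Loop programs over loop indices `X`, two-dimensional bit arrays `Y`, and stacks of bits `Z`. -/
inductive Cmd (X Y Z : Type) : Type
  | skip : Cmd X Y Z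
  | set (a : Y) (x y : X) (b : Bool) : Cmd X Y Z
  | ifBit (a : Y) (x y : X) (c₁ c₂ : Cmd X Y Z) : Cmd X Y Z
  | push (z : Z) (b : Bool) : Cmd X Y Z
  | pop (z : Z) : Cmd X Y Z
  | ifEmpty (z : Z) (c₁ c₂ : Cmd X Y Z) : Cmd X Y Z
  | forAll (x : X) (c : Cmd X Y Z) : Cmd X Y Z
  | seq (c₁ c₂ : Cmd X Y Z) : Cmd X Y Z

/-- The memory of a loop program. -/
@[ext] structure Mem (Y Z : Type) where
  /-- the arrays -/
  arr : Y → ℕ → ℕ → Bool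
  /-- the buffers -/
  buf : Z → List Bool

/-- Apply `f 0, …, f (k - 1)` in turn. -/
def iter {M : Type} (f : ℕ → M → M) (m : M) : ℕ → M
  | 0 => m
  | k + 1 => f k (iter f m k)

theorem iter_induction {M : Type} {f : ℕ → M → M} {m : M} {n : ℕ} (P : ℕ → M → Prop) (h₀ : P 0 m)
    (h : ∀ i < n, ∀ m, P i m → P (i + 1) (f i m)) : P n (iter f m n) := by
  have : ∀ k ≤ n, P k (iter f m k) := by
    intro k
    induction k with
    | zero => exact fun _ => h₀
    | succ k ih => exact fun hk => h k hk _ (ih (by omega))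
  exact this n le_rfl

variable {X Y Z : Type} [DecidableEq X] [DecidableEq Y] [DecidableEq Z]

/-- An array written row by row. -/
def arrayList (n : ℕ) (A : ℕ → ℕ → Bool) : List Bool :=
  (List.range (n * n)).map fun p => A (p / n) (p % n)

@[simp] theorem length_arrayList (n : ℕ) (A : ℕ → ℕ → Bool) : (arrayList n A).length = n * n := by
  simp [arrayList]

theorem address_lt {n x y : ℕ} (hx : x < n) (hy : y < n) : x * n + y < n * n :=
  calc x * n + y < x * n + n := by omega
    _ = (x + 1) * n := by ring
    _ ≤ n * n := Nat.mul_le_mul_right _ hx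

theorem getElem_arrayList {n x y : ℕ} {A : ℕ → ℕ → Bool} (hy : y < n)
    (h : x * n + y < (arrayList n A).length) : (arrayList n A)[x * n + y] = A x y := by
  have hn : 0 < n := by omega
  simp only [arrayList, List.getElem_map, List.getElem_range]
  rw [mul_comm, Nat.mul_add_div hn, Nat.div_eq_of_lt hy, Nat.mul_add_mod, Nat.mod_eq_of_lt hy,
    Nat.add_zero]

theorem set_arrayList {n x y : ℕ} (A : ℕ → ℕ → Bool) (hy : y < n) (b : Bool) :
    (arrayList n A).set (x * n + y) b =
      arrayList n fun i j => if i = x ∧ j = y then b else A i j := by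
  have hn : 0 < n := by omega
  refine List.ext_getElem (by simp) fun p h₁ h₂ => ?_
  simp only [List.getElem_set, arrayList, List.getElem_map, List.getElem_range]
  refine if_congr ⟨?_, ?_⟩ rfl rfl
  · rintro rfl
    rw [mul_comm, Nat.mul_add_div hn, Nat.div_eq_of_lt hy, Nat.mul_add_mod, Nat.mod_eq_of_lt hy]
    simp
  · rintro ⟨rfl, rfl⟩
    rw [mul_comm]
    exact Nat.div_add_mod p n

/-- The stacks that represent the memory `m` when the active loop indices are given by `ρ`. -/
def rep (n : ℕ) (ρ : X → Option ℕ) (m : Mem Y Z) : Cell X Y Z → List Bool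
  | .size => List.replicate n true
  | .idx x => List.replicate ((ρ x).getD 0) true
  -- During round `i` the bit of that round has already been popped, so `n - (i + 1)` bits remain.
  -- For an inactive index both stacks are empty.
  | .cnt x => List.replicate ((ρ x).elim 0 fun i => n - (i + 1)) true
  | .arr a => arrayList n (m.arr a)
  | .buf z => m.buf z
  | .tmp _ => []

namespace Prog

variable {I : Type} {d : I → Sym} {r : Reg} {i : List I} {n : ℕ} {ρ : X → Option ℕ} {m : Mem Y Z}
  {S : Cell X Y Z → List Bool}

/-- Compute the address of the entry `(x, y)` of an array. -/
def addr (x y : X) : Prog (Cell X Y Z) :=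
  seq (drain (.idx x) (seq (push (.tmp 1) fun _ => true) (addTo .size (.tmp 0) (.tmp 2))))
    (seq (move (.tmp 1) (.idx x)) (addTo (.idx y) (.tmp 0) (.tmp 2)))

/-- The row-major address `u * n + v` is built in unary: `n` is added once for each bit of the index
`x`, whose bits are saved in `tmp 1` and then moved back, and finally `v` is added. -/
theorem runs_addr {x y : X} {u v : ℕ} (hn : S .size = List.replicate n true)
    (hx : S (.idx x) = List.replicate u true) (hy : S (.idx y) = List.replicate v true)
    (h₀ : ∀ j, S (.tmp j) = []) (hu : u ≤ n) (hv : v ≤ n) :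
    Runs d (addr x y) ⟨r, i, S⟩
      ⟨none, i, update S (.tmp 2) (List.replicate (u * n + v) true)⟩ (7 * n ^ 2 + 17 * n + 8) := by
  have h₁ : Runs d
      (drain (.idx x) (seq (push (.tmp 1) fun _ => true) (addTo .size (.tmp 0) (.tmp 2))))
      ⟨r, i, S⟩ ⟨none, i, update (update (update S (.idx x) []) (.tmp 1) (List.replicate u true))
        (.tmp 2) (List.replicate (u * n) true)⟩ ((7 * n + 7) * u + 2) := by
    refine ((runs_drain (d := d) (k := .idx x)
      (p := seq (push (.tmp 1) fun _ => true) (addTo .size (.tmp 0) (.tmp 2))) (i := i)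
      (T := 7 * n + 5) (List.replicate u true)
      (fun j => update (update (update S (.idx x) (List.replicate (u - j) true))
        (.tmp 1) (List.replicate j true)) (.tmp 2) (List.replicate (j * n) true))
      ?_ ?_ r).of_eq ?_ ?_).mono (by simp)
    · intro j hj
      simp
    · intro j hj
      refine ⟨_, (((runs_push _ _ _ i _).seq (runs_addTo (m := n) (by simp) (by simp) (by simp)
        ?_ ?_ _ i)).of_eq rfl ?_).mono (by omega)⟩
      · simp [hn]
      · simp [h₀]
      · have e : List.replicate ((j + 1) * n) true =
            List.replicate n true ++ List.replicate (j * n) true := by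
          rw [add_mul, one_mul, add_comm, List.replicate_add]
        funext c
        simp only [Function.update_apply, e]
        clear e
        split_ifs <;> (try simp [List.replicate_succ]) <;> exfalso <;> simp at *
    · funext c
      simp only [Function.update_apply]
      split_ifs <;> simp_all
    · simp
  have h₂ := runs_move (d := d) (a := Cell.tmp 1) (b := Cell.idx x) (by simp) none i
    (update (update (update S (.idx x) []) (.tmp 1) (List.replicate u true))
        (.tmp 2) (List.replicate (u * n) true))
  have h₃ := runs_addTo (d := d) (a := Cell.idx y) (t := Cell.tmp 0) (b := Cell.tmp 2) (m := v)
    (S := update S (.tmp 2) (List.replicate (u * n) true)) (by simp) (by simp) (by simp)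
    (by simp [hy]) (by simp [h₀]) none i
  refine (((h₁.seq ((h₂.of_eq rfl ?_).seq h₃))).of_eq rfl ?_).mono ?_
  · funext c
    simp only [Function.update_apply]
    split_ifs <;> simp_all
  · simp [add_comm]
  · have : u * n ≤ n * n := Nat.mul_le_mul_right _ hu
    simp
    nlinarith

/-- Move as many bits of the array `a` to the scratch space as the address says. -/
def seek (a : Y) : Prog (Cell X Y Z) :=
  drain (.tmp 2) (seq (pop (.arr a)) (push (.tmp 0) bit))

theorem runs_seek {a : Y} {u : ℕ} (h₂ : S (.tmp 2) = List.replicate u true)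
    (h₀ : S (.tmp 0) = []) (hu : u ≤ (S (.arr a)).length) :
    Runs d (seek a) ⟨r, i, S⟩ ⟨none, i, update (update (update S (.tmp 2) [])
      (.tmp 0) ((S (.arr a)).take u).reverse) (.arr a) ((S (.arr a)).drop u)⟩ (4 * u + 2) := by
  refine ((runs_drain (d := d) (k := .tmp 2) (p := seq (pop (.arr a)) (push (.tmp 0) bit)) (i := i)
    (T := 2) (List.replicate u true) (fun j => update (update (update S (.tmp 2)
      (List.replicate (u - j) true)) (.tmp 0) ((S (.arr a)).take j).reverse) (.arr a)
      ((S (.arr a)).drop j)) ?_ ?_ r).of_eq ?_ ?_).mono (by simp)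
  · intro j hj
    simp
  · intro j hj
    have hlt : j < (S (.arr a)).length := by
      simp at hj
      omega
    have e : ((S (.arr a)).take (j + 1)).reverse = (S (.arr a))[j] :: ((S (.arr a)).take j).reverse := by
      rw [List.take_succ_eq_append_getElem hlt]
      simp
    refine ⟨_, ((runs_pop _ _ i _).seq (runs_push _ _ _ i _)).of_eq rfl ?_⟩
    funext c
    simp only [Function.update_apply, e, List.drop_eq_getElem_cons hlt]
    clear e
    split_ifs <;> simp_all
  · funext c
    simp only [Function.update_apply]
    split_ifs <;> simp_all
  · simp

/-- Pop the entry `(x, y)` of the array `a`, leaving the preceding entries in the scratch space. -/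
def fetch (a : Y) (x y : X) : Prog (Cell X Y Z) :=
  seq (addr x y) (seq (seek a) (pop (.arr a)))

/-- After `seek` the wanted entry is on top of its array. The array is left split there, so that
reading and writing can both be completed by a push and by moving the prefix back. -/
theorem runs_fetch {a : Y} {x y : X} {u v : ℕ} (hx : ρ x = some u) (hy : ρ y = some v) (hu : u < n)
    (hv : v < n) :
    Runs d (fetch a x y) ⟨r, i, rep n ρ m⟩ ⟨some (Sum.inr (m.arr a u v)), i,
      update (update (rep n ρ m) (.tmp 0) ((arrayList n (m.arr a)).take (u * n + v)).reverse)
        (.arr a) ((arrayList n (m.arr a)).drop (u * n + v + 1))⟩ (11 * n ^ 2 + 17 * n + 11) := by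
  have hlt := address_lt hu hv
  have hlt' : u * n + v < (arrayList n (m.arr a)).length := by simpa using hlt
  have h₁ := runs_addr (d := d) (r := r) (i := i) (x := x) (y := y) (u := u) (v := v)
    (S := rep n ρ m) (n := n) rfl (by simp [rep, hx]) (by simp [rep, hy]) (fun _ => rfl) hu.le hv.le
  have h₂ := runs_seek (d := d) (r := none) (i := i) (a := a) (u := u * n + v)
    (S := update (rep n ρ m) (.tmp 2) (List.replicate (u * n + v) true)) (by simp)
    (by simp [rep]) (by simpa [rep] using hlt.le)
  have e₁ : (arrayList n (m.arr a)).drop (u * n + v) =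
      m.arr a u v :: (arrayList n (m.arr a)).drop (u * n + v + 1) := by
    rw [List.drop_eq_getElem_cons hlt', getElem_arrayList hv]
  have h₃ := runs_pop (d := d) (Cell.arr a) none i (update (update (rep n ρ m) (.tmp 0)
    ((arrayList n (m.arr a)).take (u * n + v)).reverse)
        (.arr a) ((arrayList n (m.arr a)).drop (u * n + v)))
  rw [Function.update_self, Function.update_idem, e₁] at h₃
  refine (h₁.seq ((h₂.of_eq rfl ?_).seq h₃)).mono (by nlinarith)
  funext c
  simp only [Function.update_apply]
  split_ifs <;> simp_all [rep]

end Prog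
end StackProgram

/-! ### Semantics of loop programs and their simulation by stack programs. -/

namespace StackProgram

open Function (update)
open Prog (Runs bit)

variable {X Y Z : Type} [DecidableEq X] [DecidableEq Y] [DecidableEq Z]

/-- Set the entry `(u, v)` of the array `a` to `b`. -/
def Mem.set (m : Mem Y Z) (a : Y) (u v : ℕ) (b : Bool) : Mem Y Z where
  arr := update m.arr a fun i j => if i = u ∧ j = v then b else m.arr a i j
  buf := m.buf

/-- Set the buffer `z` to `l`. -/
def Mem.setBuf (m : Mem Y Z) (z : Z) (l : List Bool) : Mem Y Z where
  arr := m.arr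
  buf := update m.buf z l

namespace Cmd

/-- The effect of a loop program for size `n` when the active loop indices are given by `ρ`. -/
def eval (n : ℕ) : Cmd X Y Z → (X → Option ℕ) → Mem Y Z → Mem Y Z
  | skip, _, m => m
  | set a x y b, ρ, m => m.set a ((ρ x).getD 0) ((ρ y).getD 0) b
  | ifBit a x y c₁ c₂, ρ, m =>
    if m.arr a ((ρ x).getD 0) ((ρ y).getD 0) then c₁.eval n ρ m else c₂.eval n ρ m
  | push z b, _, m => m.setBuf z (b :: m.buf z)
  | pop z, _, m => m.setBuf z (m.buf z).tail
  | ifEmpty z c₁ c₂, ρ, m => if m.buf z = [] then c₁.eval n ρ m else c₂.eval n ρ m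
  | forAll x c, ρ, m => iter (fun i m => c.eval n (update ρ x (some i)) m) m n
  | seq c₁ c₂, ρ, m => c₂.eval n ρ (c₁.eval n ρ m)

/-- Arrays are accessed at active indices only, and the indices of nested loops are distinct. -/
def Valid (n : ℕ) : Cmd X Y Z → (X → Option ℕ) → Prop
  | set _ x y _, ρ => (∃ u < n, ρ x = some u) ∧ ∃ v < n, ρ y = some v
  | ifBit _ x y c₁ c₂, ρ =>
    ((∃ u < n, ρ x = some u) ∧ ∃ v < n, ρ y = some v) ∧ c₁.Valid n ρ ∧ c₂.Valid n ρ
  | ifEmpty _ c₁ c₂, ρ => c₁.Valid n ρ ∧ c₂.Valid n ρ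
  | forAll x c, ρ => ρ x = none ∧ ∀ i < n, c.Valid n (update ρ x (some i))
  | seq c₁ c₂, ρ => c₁.Valid n ρ ∧ c₂.Valid n ρ
  | _, _ => True

/-- The stack program of a loop program. -/
def toProg : Cmd X Y Z → Prog (Cell X Y Z)
  | skip => .nop
  | set a x y b => .seq (.fetch a x y) (.seq (.push (.arr a) fun _ => b) (.move (.tmp 0) (.arr a)))
  | ifBit a x y c₁ c₂ => .seq (.fetch a x y) (.seq (.push (.arr a) bit)
      (.ite bit (.seq (.move (.tmp 0) (.arr a)) c₁.toProg)
        (.seq (.move (.tmp 0) (.arr a)) c₂.toProg)))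
  | push z b => .push (.buf z) fun _ => b
  | pop z => .pop (.buf z)
  | ifEmpty z c₁ c₂ => .seq (.pop (.buf z))
      (.ite Option.isSome (.seq (.push (.buf z) bit) c₂.toProg) c₁.toProg)
  | forAll x c => .seq (.addTo .size (.tmp 0) (.cnt x))
      (.seq (.drain (.cnt x) (.seq c.toProg (.push (.idx x) fun _ => true))) (.clear (.idx x)))
  | seq c₁ c₂ => .seq c₁.toProg c₂.toProg

open Polynomial in
/-- A bound on the running time of a loop program in terms of the size. -/
noncomputable def time : Cmd X Y Z → ℕ[X]
  | skip => 1
  | set _ _ _ _ => 14 * Polynomial.X ^ 2 + 17 * Polynomial.X + 16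
  | ifBit _ _ _ c₁ c₂ => 14 * Polynomial.X ^ 2 + 17 * Polynomial.X + 16 + c₁.time + c₂.time
  | push _ _ => 1
  | pop _ => 1
  | ifEmpty _ c₁ c₂ => c₁.time + c₂.time + 3
  -- Per round: 7 for copying the size to the counter, 3 for the push, pop and test, and 3 for
  -- clearing the index afterwards. The constants of the three routines are 4, 2 and 2.
  | forAll _ c => (c.time + 13) * Polynomial.X + 8
  | seq c₁ c₂ => c₁.time + c₂.time

variable {I : Type} {d : I → Sym} {r : Reg} {i : List I} {n : ℕ} {ρ : X → Option ℕ} {m : Mem Y Z}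

theorem rep_update (x : X) (j : ℕ) (m : Mem Y Z) : rep n (update ρ x (some j)) m =
    update (update (rep n ρ m) (.cnt x) (List.replicate (n - (j + 1)) true)) (.idx x)
      (List.replicate j true) := by
  funext c
  rcases c with _ | y | y | a | z | j
  · simp [rep]
  · by_cases h : y = x
    · subst h
      simp [rep]
    · simp [rep, h]
  · by_cases h : y = x
    · subst h
      simp [rep]
    · simp [rep, h]
  · simp [rep]
  · simp [rep]
  · simp [rep]

/-- The prefix lies reversed in the scratch space, so moving it back onto `b` and the suffix yields
the array list with one entry replaced, by `List.set_eq_take_append_cons_drop`. -/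
theorem runs_restore {a : Y} {u v : ℕ} (hu : u < n) (hv : v < n) (b : Bool) :
    Runs d (.move (.tmp 0) (.arr a)) ⟨r, i, update (update (rep n ρ m) (.tmp 0)
        ((arrayList n (m.arr a)).take (u * n + v)).reverse)
        (.arr a) (b :: (arrayList n (m.arr a)).drop (u * n + v + 1))⟩
      ⟨none, i, rep n ρ (m.set a u v b)⟩ (3 * n ^ 2 + 2) := by
  have hlt := address_lt hu hv
  refine ((Prog.runs_move (d := d) (a := Cell.tmp 0) (b := Cell.arr a) (by simp) r i _).of_eq
    rfl ?_).mono ?_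
  · have e := set_arrayList (m.arr a) hv b (x := u)
    rw [List.set_eq_take_append_cons_drop, if_pos (by simpa using hlt)] at e
    funext c
    rcases c with _ | x | x | a' | z | j
    · simp [rep]
    · simp [rep]
    · simp [rep]
    · by_cases h : a' = a
      · subst h
        simp [rep, e, Mem.set]
      · simp [rep, h, Mem.set]
    · simp [rep, Mem.set]
    · by_cases h : j = 0
      · subst h
        simp [rep]
      · simp [rep, h]
  · have : u * n + v ≤ n ^ 2 := by nlinarith
    simp
    omega

/-- Simulation, by induction on the program. The initial register is arbitrary and the final one
unspecified because no compiled command depends on the register that it finds. -/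
theorem runs_toProg (c : Cmd X Y Z) (hc : c.Valid n ρ) (m : Mem Y Z) (r : Reg) :
    ∃ r', Runs d c.toProg ⟨r, i, rep n ρ m⟩ ⟨r', i, rep n ρ (c.eval n ρ m)⟩ (c.time.eval n) := by
  induction c generalizing ρ m r with
  | skip => exact ⟨r, Prog.runs_nop.mono (by simp [time])⟩
  | set a x y b =>
    obtain ⟨⟨u, hu, hx⟩, v, hv, hy⟩ := hc
    refine ⟨none, ((Prog.runs_fetch hx hy hu hv).seq (((Prog.runs_push _ _ _ _ _).of_eq rfl ?_).seq
      (runs_restore (m := m) (ρ := ρ) hu hv b))).of_eq rfl ?_ |>.mono ?_⟩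
    · simp
    · simp [eval, hx, hy]
    · simp [time]
      omega
  | ifBit a x y c₁ c₂ ih₁ ih₂ =>
    obtain ⟨⟨⟨u, hu, hx⟩, v, hv, hy⟩, hc₁, hc₂⟩ := hc
    -- A read is treated as writing back the value that was read, so `runs_restore` applies.
    have e : rep n ρ m = rep n ρ (m.set a u v (m.arr a u v)) := by
      congr
      refine Mem.ext ?_ rfl
      simp only [Mem.set]
      rw [eq_comm, Function.update_eq_self_iff]
      funext i j
      split_ifs with h
      · rw [h.1, h.2]
      · rfl
    have hr := runs_restore (d := d) (i := i) (ρ := ρ) (m := m) (a := a) hu hv (m.arr a u v)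
      (r := some (Sum.inr (m.arr a u v)))
    rw [← e] at hr
    by_cases hb : m.arr a u v = true
    · obtain ⟨r', h⟩ := ih₁ hc₁ m none
      refine ⟨r', ((Prog.runs_fetch hx hy hu hv).seq (((Prog.runs_push _ _ _ _ _).of_eq rfl ?_).seq
        ((hr.seq h).ite_true ?_))).of_eq rfl ?_ |>.mono ?_⟩
      · simp
      · simp [hb]
      · simp [eval, hx, hy, hb]
      · simp [time]
        omega
    · obtain ⟨r', h⟩ := ih₂ hc₂ m none
      refine ⟨r', ((Prog.runs_fetch hx hy hu hv).seq (((Prog.runs_push _ _ _ _ _).of_eq rfl ?_).seq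
        ((hr.seq h).ite_false ?_))).of_eq rfl ?_ |>.mono ?_⟩
      · simp
      · simp [hb]
      · simp [eval, hx, hy, hb]
      · simp [time]
        omega
  | push z b =>
    refine ⟨r, ((Prog.runs_push _ _ _ _ _).of_eq rfl ?_).mono (by simp [time])⟩
    funext c
    rcases c with _ | x | x | a | z' | j
    · simp [rep]
    · simp [rep]
    · simp [rep]
    · simp [rep, eval, Mem.setBuf]
    · by_cases h : z' = z
      · subst h
        simp [rep, eval, Mem.setBuf]
      · simp [rep, eval, Mem.setBuf, h]
    · simp [rep]
  | pop z =>
    refine ⟨_, ((Prog.runs_pop _ _ _ _).of_eq rfl ?_).mono (by simp [time])⟩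
    funext c
    rcases c with _ | x | x | a | z' | j
    · simp [rep]
    · simp [rep]
    · simp [rep]
    · simp [rep, eval, Mem.setBuf]
    · by_cases h : z' = z
      · subst h
        simp [rep, eval, Mem.setBuf]
      · simp [rep, eval, Mem.setBuf, h]
    · simp [rep]
  | ifEmpty z c₁ c₂ ih₁ ih₂ =>
    have h₀ := Prog.runs_pop (d := d) (Cell.buf z) r i (rep n ρ m)
    rcases hz : m.buf z with _ | ⟨b, l⟩
    · obtain ⟨r', h⟩ := ih₁ hc.1 m none
      have e : rep n ρ m (Cell.buf z) = [] := hz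
      have e' : update (rep n ρ m) (Cell.buf z) [] = rep n ρ m := by
        rw [Function.update_eq_self_iff, e]
      rw [e] at h₀
      refine ⟨r', (h₀.seq (((h.of_eq e'.symm rfl).ite_false ?_))).of_eq rfl ?_ |>.mono ?_⟩
      · rfl
      · simp [eval, hz]
      · simp [time]
        omega
    · obtain ⟨r', h⟩ := ih₂ hc.2 m (some (Sum.inr b))
      have e : rep n ρ m (Cell.buf z) = b :: l := hz
      rw [e] at h₀
      refine ⟨r', (h₀.seq (Runs.ite_true (((Prog.runs_push _ _ _ _ _).of_eq rfl ?_).seq h) ?_)).of_eq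
        rfl ?_ |>.mono ?_⟩
      · simp [e]
      · rfl
      · simp [eval, hz]
      · simp [time]
        omega
  | forAll x c ih =>
    obtain ⟨hx, hc⟩ := hc
    set f : ℕ → Mem Y Z → Mem Y Z := fun i m => c.eval n (update ρ x (some i)) m with hf
    have h₁ := Prog.runs_addTo (d := d) (a := Cell.size) (t := Cell.tmp 0) (b := Cell.cnt x) (m := n)
      (S := rep n ρ m) (by simp) (by simp) (by simp) rfl rfl r i
    -- Invariant between rounds: the memory after `j` rounds, `n - j` bits on the counter and `j`
    -- bits on the index stack.
    have h₂ := Prog.runs_drain (d := d) (k := Cell.cnt x)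
      (p := .seq c.toProg (.push (.idx x) fun _ => true)) (i := i)
      (T := c.time.eval n + 1) (List.replicate n true)
      (fun j => update (update (rep n ρ (iter f m j)) (.cnt x) (List.replicate (n - j) true)) (.idx x)
        (List.replicate j true)) (by simp) ?_ none
    · have h₃ := Prog.runs_clear (d := d) (Cell.idx x) none i (update (update (rep n ρ (iter f m n))
        (.cnt x) (List.replicate (n - n) true)) (.idx x) (List.replicate n true))
      refine ⟨none, ((h₁.of_eq rfl ?_).seq ((h₂.of_eq rfl ?_).seq h₃)).of_eq rfl ?_ |>.mono ?_⟩
      · funext c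
        simp only [Function.update_apply]
        split_ifs <;> simp_all [rep, iter]
      · simp
      · change _ = rep n ρ (iter f m n)
        funext c
        simp only [Function.update_apply]
        split_ifs <;> simp_all [rep]
      · simp [time]
        ring_nf
        omega
    · intro j hj
      have hj' : j < n := by simpa using hj
      obtain ⟨r', h⟩ := ih (hc j hj') (iter f m j) (some (Sum.inr true))
      rw [rep_update, rep_update] at h
      simp only [List.getElem_replicate]
      refine ⟨r', ((h.of_eq ?_ rfl).seq ((Prog.runs_push _ _ _ _ _).of_eq rfl ?_))⟩
      · funext c
        simp only [Function.update_apply]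
        split_ifs <;> simp_all
      · change _ = update (update (rep n ρ (f j (iter f m j))) _ _) _ _
        funext c
        simp only [Function.update_apply, hf]
        split_ifs <;> simp_all [List.replicate_succ]
  | seq c₁ c₂ ih₁ ih₂ =>
    obtain ⟨r₁, h₁⟩ := ih₁ hc.1 m r
    obtain ⟨r₂, h₂⟩ := ih₂ hc.2 (c₁.eval n ρ m) r₁
    exact ⟨r₂, (h₁.seq h₂).mono (by simp [time])⟩

end Cmd
end StackProgram

/-! ### The algorithm as a loop program, and the effect of the elimination. -/

namespace StackProgram

open Function (update)

section Iterate

variable {M : Type} {f : ℕ → M → M} {m m₀ m₁ : M} {n : ℕ}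

theorem iter_eq_self (h : ∀ i < n, f i m = m) : iter f m n = m :=
  iter_induction (fun _ m' => m' = m) rfl (by rintro i hi _ rfl; exact h i hi)

/-- A search loop is a latch: the memory is `m₀` until the first hit and `m₁` ever after. -/
theorem iter_search {P : ℕ → Prop} (h₀ : ∀ i < n, ¬ P i → f i m₀ = m₀)
    (h₀' : ∀ i < n, P i → f i m₀ = m₁) (h₁ : ∀ i < n, f i m₁ = m₁) :
    (∀ i < n, ¬ P i) ∧ iter f m₀ n = m₀ ∨ (∃ i < n, P i) ∧ iter f m₀ n = m₁ := by
  refine iter_induction (fun k m' => (∀ i < k, ¬ P i) ∧ m' = m₀ ∨ (∃ i < k, P i) ∧ m' = m₁)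
    (Or.inl ⟨by simp, rfl⟩) ?_
  rintro k hk m' (⟨hP, rfl⟩ | ⟨⟨i, hi, hP⟩, rfl⟩)
  · by_cases h : P k
    · exact Or.inr ⟨⟨k, by omega, h⟩, h₀' k hk h⟩
    · refine Or.inl ⟨fun i hi => ?_, h₀ k hk h⟩
      obtain hi | rfl : i < k ∨ i = k := by omega
      exacts [hP i hi, h]
  · exact Or.inr ⟨⟨i, by omega, hP⟩, h₁ k hk⟩

end Iterate

/-- The number of `w < n` with `p w`. -/
def count (n : ℕ) (p : ℕ → Bool) : ℕ := ((Finset.range n).filter fun w => p w = true).card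

theorem count_succ (n : ℕ) (p : ℕ → Bool) : count (n + 1) p = count n p + (p n).toNat := by
  unfold count
  rw [Finset.range_add_one, Finset.filter_insert]
  cases h : p n <;> simp

theorem count_le (n : ℕ) (p : ℕ → Bool) : count n p ≤ n :=
  (Finset.card_filter_le _ _).trans (by simp)

/-- The loop indices. -/
inductive Index : Type
  | t | u | v | w
  deriving DecidableEq

instance : Fintype Index where
  elems := {.t, .u, .v, .w}
  complete x := by cases x <;> decide

/-- The arrays: the closed adjacency matrix, the cliques found so far, and the solution (on the
diagonal). -/
inductive Table : Type
  | adj | clique | sol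
  deriving DecidableEq

instance : Fintype Table where
  elems := {.adj, .clique, .sol}
  complete x := by cases x <;> decide

/-- The buffers. -/
inductive Buffer : Type
  | flag | sel | out | matrix | revNum | num | tally | half
  deriving DecidableEq

instance : Fintype Buffer where
  elems := {.flag, .sel, .out, .matrix, .revNum, .num, .tally, .half}
  complete x := by cases x <;> decide

/-- The loop programs of the algorithm. -/
abbrev Code : Type := Cmd Index Table Buffer

/-- The memory of the algorithm. -/
abbrev Memory : Type := Mem Table Buffer

/-- Replace an array. -/
def Mem.setArr {Y Z : Type} [DecidableEq Y] (m : Mem Y Z) (a : Y) (A : ℕ → ℕ → Bool) : Mem Y Z where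
  arr := update m.arr a A
  buf := m.buf

namespace Code

open Index Table Buffer
open Cmd hiding push pop skip seq set time

/-- Make the adjacency matrix reflexive. -/
def close : Code := forAll v (.set adj v v true)

/-- Raise the flag if `u`, `w` are not yet eliminated, adjacent to `v`, and not adjacent. -/
def checkPair : Code :=
  -- The diagonal of `clique` marks the eliminated vertices: `adj` is reflexive by now, so recording
  -- the neighbours of `v` also sets the entry `(v, v)`. Reflexivity also excludes `u = w` from
  -- being a violation.
  ifBit clique u u .skip <| ifBit clique w w .skip <|
    ifBit adj v u (ifBit adj v w (ifBit adj u w .skip (ifEmpty flag (.push flag true) .skip)) .skip)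
      .skip

/-- Record the neighbours of `v` that are not yet eliminated. -/
def record : Code :=
  forAll u <| ifBit clique u u .skip <| ifBit adj v u (.set clique v u true) .skip

/-- Eliminate `v` if it is simplicial. -/
def visit : Code :=
  ifBit clique v v .skip <| .seq (forAll u (forAll w checkPair)) (ifEmpty flag record (.pop flag))

/-- Find a perfect elimination ordering. -/
def eliminate : Code := forAll t (forAll v visit)

/-- Push the number of vertices in the solution onto the buffer `z`, in unary. -/
def countSol (z : Buffer) : Code := forAll w (ifBit sol w w (.push z true) .skip)

/-- Subtract the number of vertices outside two cliques. -/
def subtract : Code := forAll w (ifBit clique u w .skip (ifBit clique v w .skip (.pop flag)))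

/-- Replace the solution by the vertices outside two cliques. -/
def replace : Code :=
  forAll w (ifBit clique u w (.set sol w w false)
    (ifBit clique v w (.set sol w w false) (.set sol w w true)))

/-- Replace the solution if this makes it smaller. -/
def improve : Code :=
  .seq (countSol flag)
    (.seq subtract (ifEmpty flag .skip (.seq (forAll w (.pop flag)) replace)))

/-- Find two cliques that cover as many vertices as possible. -/
def optimise : Code := forAll u (forAll v improve)

/-- The algorithm. -/
def solve : Code := .seq close (.seq eliminate optimise)

/-- Push the bits of the solution onto a buffer. -/
def emit : Code := forAll w (ifBit sol w w (.push sel true) (.push sel false))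

theorem valid_solve (n : ℕ) : solve.Valid n fun _ => none := by
  simp +contextual [solve, close, eliminate, optimise, visit, record, checkPair, improve, countSol,
    subtract, replace, Valid]

theorem valid_emit (n : ℕ) : emit.Valid n fun _ => none := by
  simp +contextual [emit, Valid]

theorem valid_countSol (n : ℕ) (z : Buffer) : (countSol z).Valid n fun _ => none := by
  simp +contextual [countSol, Valid]

variable {n a b c : ℕ} {ρ : Index → Option ℕ} {m : Memory}

theorem setArr_self (x : Table) : m.setArr x (m.arr x) = m :=
  Mem.ext (Function.update_eq_self _ _) rfl

/-- The reflexive closure of a matrix. -/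
def closed (A : ℕ → ℕ → Bool) (n : ℕ) : ℕ → ℕ → Bool := fun i j =>
  if i = j ∧ i < n then true else A i j

theorem eval_close : close.eval n ρ m = m.setArr adj (closed (m.arr adj) n) := by
  refine iter_induction (fun k m' => m' = m.setArr adj (closed (m.arr adj) k)) ?_ ?_
  · have : closed (m.arr adj) 0 = m.arr adj := by
      funext i j
      simp [closed]
    rw [this, setArr_self]
  · rintro k hk _ rfl
    refine Mem.ext ?_ rfl
    simp only [eval, Mem.set, Mem.setArr, Function.update_self, Option.getD_some,
      Function.update_idem]
    congr 1
    funext i j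
    simp only [closed]
    grind

/-- An obstruction to `a` being simplicial among the vertices not on the diagonal of `C`. -/
def Violates (A C : ℕ → ℕ → Bool) (a b c : ℕ) : Prop :=
  C b b = false ∧ C c c = false ∧ A a b = true ∧ A a c = true ∧ A b c = false

theorem eval_checkPair (ha : ρ v = some a) (hb : ρ u = some b) (hc : ρ w = some c) :
    (Violates (m.arr adj) (m.arr clique) a b c → m.buf flag = [] →
      checkPair.eval n ρ m = m.setBuf flag [true]) ∧
    (¬ Violates (m.arr adj) (m.arr clique) a b c ∨ m.buf flag ≠ [] →
      checkPair.eval n ρ m = m) := by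
  simp only [checkPair, eval, ha, hb, hc, Option.getD_some, Violates]
  constructor
  · rintro ⟨h₁, h₂, h₃, h₄, h₅⟩ h
    simp [*]
  · intro h
    split_ifs <;> simp_all

theorem eval_check (ha : ρ v = some a) (hm : m.buf flag = []) :
    (∀ b < n, ∀ c < n, ¬ Violates (m.arr adj) (m.arr clique) a b c) ∧
        (forAll u (forAll w checkPair)).eval n ρ m = m ∨
      (∃ b < n, ∃ c < n, Violates (m.arr adj) (m.arr clique) a b c) ∧
        (forAll u (forAll w checkPair)).eval n ρ m = m.setBuf flag [true] := by
  have key : ∀ b, (∀ c < n, ¬ Violates (m.arr adj) (m.arr clique) a b c) ∧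
        (forAll w checkPair).eval n (update ρ u (some b)) m = m ∨
      (∃ c < n, Violates (m.arr adj) (m.arr clique) a b c) ∧
        (forAll w checkPair).eval n (update ρ u (some b)) m = m.setBuf flag [true] := by
    intro b
    refine iter_search (fun c _ h => ?_) (fun c _ h => ?_) (fun c _ => ?_)
    · exact (eval_checkPair (by simp [ha]) (by simp) (by simp)).2 (Or.inl h)
    · exact (eval_checkPair (by simp [ha]) (by simp) (by simp)).1 h hm
    · exact (eval_checkPair (a := a) (b := b) (c := c) (by simp [ha]) (by simp) (by simp)).2
        (Or.inr (by simp [Mem.setBuf]))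
  have := iter_search (n := n) (m₀ := m) (m₁ := m.setBuf flag [true])
    (f := fun b m => (forAll w checkPair).eval n (update ρ u (some b)) m)
    (P := fun b => ∃ c < n, Violates (m.arr adj) (m.arr clique) a b c)
    (fun b _ h => ((key b).resolve_right fun h' => h h'.1).2)
    (fun b _ h => ((key b).resolve_left fun h' => by obtain ⟨c, hc, h⟩ := h; exact h'.1 c hc h).2)
    (fun b _ => iter_eq_self fun c _ => (eval_checkPair (a := a) (b := b) (c := c) (by simp [ha])
      (by simp) (by simp)).2 (Or.inr (by simp [Mem.setBuf])))
  simp only [not_exists, not_and] at this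
  exact this

/-- The effect of recording the clique of `a`. -/
def recorded (A C : ℕ → ℕ → Bool) (n a : ℕ) : ℕ → ℕ → Bool := fun i j =>
  C i j || (decide (i = a) && decide (j < n) && !C j j && A a j)

theorem eval_record (ha : ρ v = some a) : record.eval n ρ m =
    m.setArr clique (recorded (m.arr adj) (m.arr clique) n a) := by
  refine iter_induction
    (fun k m' => m' = m.setArr clique (recorded (m.arr adj) (m.arr clique) k a)) ?_ ?_
  · have : recorded (m.arr adj) (m.arr clique) 0 a = m.arr clique := by
      funext i j
      simp [recorded]
    rw [this, setArr_self]
  · rintro k hk _ rfl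
    have hu : (some k : Option ℕ).getD 0 = k := rfl
    simp only [eval, ha, Option.getD_some, Function.update_self, Mem.setArr,
      Function.update_of_ne (show v ≠ u by decide), Function.update_of_ne (show adj ≠ clique by decide)]
    -- Round `k` tests the diagonal entry `(k, k)`. Earlier rounds wrote only to columns below `k`,
    -- so the entry is unchanged even when `k = a`.
    have e : recorded (m.arr adj) (m.arr clique) k a k k = m.arr clique k k := by
      simp [recorded]
    rw [e]
    split_ifs with h₁ h₂
    · refine Mem.ext ?_ rfl
      change update _ _ _ = update _ _ _
      congr 1
      funext i j
      simp only [recorded]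
      grind
    · refine Mem.ext ?_ rfl
      simp only [Mem.set, Function.update_self, Function.update_idem]
      congr 1
      funext i j
      simp only [recorded]
      grind
    · refine Mem.ext ?_ rfl
      change update _ _ _ = update _ _ _
      congr 1
      funext i j
      simp only [recorded]
      grind

open scoped Classical in
/-- The effect of visiting `a`. -/
noncomputable def visited (A : ℕ → ℕ → Bool) (n a : ℕ) (C : ℕ → ℕ → Bool) : ℕ → ℕ → Bool :=
  if C a a = false ∧ ∀ b < n, ∀ c < n, ¬ Violates A C a b c then recorded A C n a else C

theorem eval_visit (ha : ρ v = some a) (hm : m.buf flag = []) :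
    visit.eval n ρ m = m.setArr clique (visited (m.arr adj) n a (m.arr clique)) := by
  change (if m.arr clique ((ρ v).getD 0) ((ρ v).getD 0) then m else
    (ifEmpty flag record (.pop flag)).eval n ρ ((forAll u (forAll w checkPair)).eval n ρ m)) = _
  rw [ha, Option.getD_some, visited]
  by_cases h : m.arr clique a a = true
  · simp [h, setArr_self]
  · rw [if_neg h]
    have h' : m.arr clique a a = false := by simpa using h
    obtain ⟨h₁, h₂⟩ | ⟨h₁, h₂⟩ := eval_check (n := n) ha hm
    · rw [if_pos ⟨h', h₁⟩, h₂]
      change (if _ then _ else _) = _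
      rw [if_pos hm, eval_record ha]
    · rw [if_neg, setArr_self, h₂]
      · change (if _ then _ else _) = _
        rw [if_neg (by simp [Mem.setBuf])]
        refine Mem.ext rfl ?_
        simp [eval, Mem.setBuf, ← hm]
      · rintro ⟨_, h⟩
        obtain ⟨b, hb, c, hc, h₁⟩ := h₁
        exact h b hb c hc h₁

/-- The effect of eliminating all simplicial vertices, `k` times. -/
noncomputable def eliminated (A : ℕ → ℕ → Bool) (n k : ℕ) (C : ℕ → ℕ → Bool) : ℕ → ℕ → Bool :=
  iter (fun _ C => iter (visited A n) C n) C k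

theorem eval_eliminate (hm : m.buf flag = []) :
    eliminate.eval n ρ m = m.setArr clique (eliminated (m.arr adj) n n (m.arr clique)) := by
  refine iter_induction
    (fun k m' => m' = m.setArr clique (eliminated (m.arr adj) n k (m.arr clique))) ?_ ?_
  · exact (setArr_self _).symm
  · rintro k hk _ rfl
    refine iter_induction (fun l m' => m' = m.setArr clique
      (iter (visited (m.arr adj) n) (eliminated (m.arr adj) n k (m.arr clique)) l)) rfl ?_
    rintro l hl _ rfl
    rw [eval_visit (a := l) (by simp) (by exact hm)]
    simp [Mem.setArr, iter]

end Code
end StackProgram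

/-! ### The effect of trying all pairs of cliques. -/

namespace StackProgram

open Function (update)

namespace Code

open Index Table Buffer
open Cmd hiding push pop skip seq set time

variable {n a b c : ℕ} {ρ : Index → Option ℕ} {m : Memory}

@[simp] theorem setBuf_setBuf (z : Buffer) (l l' : List Bool) :
    (m.setBuf z l).setBuf z l' = m.setBuf z l' :=
  Mem.ext rfl (Function.update_idem _ _ _)

@[simp] theorem buf_setBuf (z : Buffer) (l : List Bool) : (m.setBuf z l).buf z = l :=
  Function.update_self _ _ _

@[simp] theorem arr_setBuf (z : Buffer) (l : List Bool) : (m.setBuf z l).arr = m.arr := rfl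

theorem setBuf_self (z : Buffer) : m.setBuf z (m.buf z) = m :=
  Mem.ext rfl (Function.update_eq_self _ _)

/-- The vertices outside two cliques. -/
def outside (C : ℕ → ℕ → Bool) (a b w : ℕ) : Bool := !(C a w || C b w)

theorem eval_countSol (z : Buffer) : (countSol z).eval n ρ m =
    m.setBuf z (List.replicate (count n fun w => m.arr sol w w) true ++ m.buf z) := by
  refine iter_induction (fun k m' => m' =
    m.setBuf z (List.replicate (count k fun w => m.arr sol w w) true ++ m.buf z)) ?_ ?_
  · exact (setBuf_self z).symm
  · rintro k hk _ rfl
    simp only [eval, Function.update_self, Option.getD_some, count_succ]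
    change (if m.arr sol k k = true then _ else _) = _
    split_ifs with h <;> simp [h, List.replicate_succ]

theorem eval_subtract (ha : ρ u = some a) (hb : ρ v = some b) : subtract.eval n ρ m =
    m.setBuf flag ((m.buf flag).drop (count n (outside (m.arr clique) a b))) := by
  refine iter_induction (fun k m' => m' =
    m.setBuf flag ((m.buf flag).drop (count k (outside (m.arr clique) a b)))) ?_ ?_
  · exact (setBuf_self flag).symm
  · rintro k hk _ rfl
    simp only [eval, Function.update_self, Option.getD_some, count_succ,
      Function.update_of_ne (show u ≠ w by decide), Function.update_of_ne (show v ≠ w by decide),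
      ha, hb, outside]
    change (if m.arr clique a k = true then _ else if m.arr clique b k = true then _ else _) = _
    split_ifs with h h' <;> simp [*]

theorem eval_pops : (forAll w (.pop flag)).eval n ρ m =
    m.setBuf flag ((m.buf flag).drop n) := by
  refine iter_induction (fun k m' => m' = m.setBuf flag ((m.buf flag).drop k)) ?_ ?_
  · exact (setBuf_self flag).symm
  · rintro k hk _ rfl
    simp [eval]

/-- Replace the diagonal of `S` by the vertices outside two cliques. -/
def replaced (C S : ℕ → ℕ → Bool) (n a b : ℕ) : ℕ → ℕ → Bool := fun i j =>
  if i = j ∧ i < n then outside C a b i else S i j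

theorem eval_replace (ha : ρ u = some a) (hb : ρ v = some b) : replace.eval n ρ m =
    m.setArr sol (replaced (m.arr clique) (m.arr sol) n a b) := by
  refine iter_induction
    (fun k m' => m' = m.setArr sol (replaced (m.arr clique) (m.arr sol) k a b)) ?_ ?_
  · have : replaced (m.arr clique) (m.arr sol) 0 a b = m.arr sol := by
      funext i j
      simp [replaced]
    rw [this, setArr_self]
  · rintro k hk _ rfl
    simp only [eval, Function.update_self, Option.getD_some,
      Function.update_of_ne (show u ≠ w by decide), Function.update_of_ne (show v ≠ w by decide),
      ha, hb]
    change (if m.arr clique a k = true then _ else if m.arr clique b k = true then _ else _) = _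
    split_ifs with h h'
    all_goals
      refine Mem.ext ?_ rfl
      simp only [Mem.set, Mem.setArr, Function.update_self, Function.update_idem]
      congr 1
      funext i j
      simp only [replaced, outside]
      grind

/-- The effect of trying the cliques of `a` and `b`. -/
def improved (C : ℕ → ℕ → Bool) (n a b : ℕ) (S : ℕ → ℕ → Bool) : ℕ → ℕ → Bool :=
  if count n (fun w => S w w) ≤ count n (outside C a b) then S else replaced C S n a b

/-- The flag buffer serves as a unary counter. After the subtraction it holds the truncated
difference of the two sizes, so it is nonempty exactly when the new set is strictly smaller; it has
at most `n` bits, hence `n` pops empty it. -/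
theorem eval_improve (ha : ρ u = some a) (hb : ρ v = some b) (hm : m.buf flag = []) :
    improve.eval n ρ m = m.setArr sol (improved (m.arr clique) n a b (m.arr sol)) := by
  change (ifEmpty flag .skip (.seq (forAll w (.pop flag)) replace)).eval n ρ
    (subtract.eval n ρ ((countSol flag).eval n ρ m)) = _
  rw [eval_countSol, eval_subtract ha hb, setBuf_setBuf, buf_setBuf, arr_setBuf, hm,
    List.append_nil, List.drop_replicate]
  change (if (m.setBuf flag _).buf flag = [] then m.setBuf flag _ else
    replace.eval n ρ ((forAll w (.pop flag)).eval n ρ (m.setBuf flag _))) = _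
  rw [buf_setBuf]
  have hc := count_le n fun w => m.arr sol w w
  change (if List.replicate (_ - count n (outside (m.arr clique) a b)) true = [] then _ else _) = _
  by_cases h : count n (fun w => m.arr sol w w) ≤ count n (outside (m.arr clique) a b)
  · rw [if_pos (by simpa using Nat.sub_eq_zero_of_le h), improved, if_pos h, setArr_self,
      Nat.sub_eq_zero_of_le h, List.replicate_zero, ← hm, setBuf_self]
  · rw [if_neg (by simp; omega), improved, if_neg h, eval_pops, buf_setBuf, List.drop_replicate,
      setBuf_setBuf, Nat.sub_eq_zero_of_le (by omega : _ ≤ n), List.replicate_zero, ← hm,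
      setBuf_self, eval_replace ha hb]

/-- The effect of trying all pairs of cliques. -/
def optimised (C : ℕ → ℕ → Bool) (n : ℕ) (S : ℕ → ℕ → Bool) : ℕ → ℕ → Bool :=
  iter (fun a S => iter (improved C n a) S n) S n

theorem eval_optimise (hm : m.buf flag = []) :
    optimise.eval n ρ m = m.setArr sol (optimised (m.arr clique) n (m.arr sol)) := by
  refine iter_induction (fun k m' => m' = m.setArr sol
    (iter (fun a S => iter (improved (m.arr clique) n a) S n) (m.arr sol) k)) ?_ ?_
  · exact (setArr_self _).symm
  · rintro k hk _ rfl
    refine iter_induction (fun l m' => m' = m.setArr sol (iter (improved (m.arr clique) n k)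
      (iter (fun a S => iter (improved (m.arr clique) n a) S n) (m.arr sol) k) l)) rfl ?_
    rintro l hl _ rfl
    rw [eval_improve (a := k) (b := l) (by simp) (by simp) (by exact hm)]
    simp [Mem.setArr, iter]

theorem eval_solve (hm : m.buf flag = []) : solve.eval n ρ m =
    ((m.setArr adj (closed (m.arr adj) n)).setArr clique
      (eliminated (closed (m.arr adj) n) n n (m.arr clique))).setArr sol
        (optimised (eliminated (closed (m.arr adj) n) n n (m.arr clique)) n (m.arr sol)) := by
  change optimise.eval n ρ (eliminate.eval n ρ (close.eval n ρ m)) = _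
  rw [eval_close, eval_eliminate (by exact hm), eval_optimise (by exact hm)]
  simp [Mem.setArr]

theorem eval_emit : emit.eval n ρ m =
    m.setBuf sel (((List.range n).map fun w => m.arr sol w w).reverse ++ m.buf sel) := by
  refine iter_induction (fun k m' => m' =
    m.setBuf sel (((List.range k).map fun w => m.arr sol w w).reverse ++ m.buf sel)) ?_ ?_
  · exact (setBuf_self sel).symm
  · rintro k hk _ rfl
    simp only [eval, Function.update_self, Option.getD_some]
    change (if m.arr sol k k = true then _ else _) = _
    split_ifs with h <;> simp [h, List.range_succ]

/-- Two invariants suffice: the diagonal is either still full or the outside of some pair of rows,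
and its count never increases, so the bound gained from a pair persists. -/
theorem optimised_spec (C : ℕ → ℕ → Bool) (n : ℕ) {S : ℕ → ℕ → Bool} (hS : ∀ w < n, S w w = true) :
    ((∀ w < n, optimised C n S w w = true) ∨
      ∃ a < n, ∃ b < n, ∀ w < n, optimised C n S w w = outside C a b w) ∧
    ∀ a < n, ∀ b < n, count n (fun w => optimised C n S w w) ≤ count n (outside C a b) := by
  have hr : ∀ S a b, count n (fun w => replaced C S n a b w w) = count n (outside C a b) := by
    intro S a b
    unfold count
    congr 1
    refine Finset.filter_congr fun w hw => ?_
    simp [replaced, Finset.mem_range.1 hw]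
  have hi : ∀ S a b, count n (fun w => improved C n a b S w w) ≤ count n (outside C a b) ∧
      count n (fun w => improved C n a b S w w) ≤ count n (fun w => S w w) := by
    intro S a b
    unfold improved
    split_ifs with h
    · exact ⟨h, le_rfl⟩
    · rw [hr]
      exact ⟨le_rfl, by omega⟩
  have hi' : ∀ S, ∀ a < n, ∀ b < n, ((∀ w < n, S w w = true) ∨
      ∃ a < n, ∃ b < n, ∀ w < n, S w w = outside C a b w) →
      ((∀ w < n, improved C n a b S w w = true) ∨
      ∃ a' < n, ∃ b' < n, ∀ w < n, improved C n a b S w w = outside C a' b' w) := by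
    intro S a ha b hb h
    unfold improved
    split_ifs
    · exact h
    · exact Or.inr ⟨a, ha, b, hb, fun w hw => by simp [replaced, hw]⟩
  refine iter_induction (fun k (S : ℕ → ℕ → Bool) => ((∀ w < n, S w w = true) ∨
      ∃ a < n, ∃ b < n, ∀ w < n, S w w = outside C a b w) ∧
    ∀ a < k, ∀ b < n, count n (fun w => S w w) ≤ count n (outside C a b)) ⟨Or.inl hS, by simp⟩ ?_
  rintro k hk S ⟨h₁, h₂⟩
  have := iter_induction (f := improved C n k) (m := S) (n := n)
    (fun l (S : ℕ → ℕ → Bool) => ((∀ w < n, S w w = true) ∨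
      ∃ a < n, ∃ b < n, ∀ w < n, S w w = outside C a b w) ∧
    (∀ a < k, ∀ b < n, count n (fun w => S w w) ≤ count n (outside C a b)) ∧
    ∀ b < l, count n (fun w => S w w) ≤ count n (outside C k b)) ⟨h₁, h₂, by simp⟩ ?_
  · refine ⟨this.1, fun a ha => ?_⟩
    obtain ha | rfl : a < k ∨ a = k := by omega
    exacts [this.2.1 a ha, this.2.2]
  · rintro l hl S ⟨h₁, h₂, h₃⟩
    refine ⟨hi' S k hk l hl h₁, fun a ha b hb => (hi S k l).2.trans (h₂ a ha b hb), fun b hb => ?_⟩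
    obtain hb | rfl : b < l ∨ b = l := by omega
    exacts [(hi S k l).2.trans (h₃ b hb), (hi S k b).1]

end Code
end StackProgram

/-! ### Correctness of the elimination. -/

namespace StackProgram

namespace Code

variable {A C D : ℕ → ℕ → Bool} {n a : ℕ}

/-- The invariant of the elimination: the rows of `C` are cliques, empty for the vertices not yet
eliminated, and every clique with an eliminated vertex lies in a row. -/
structure Eliminating (A : ℕ → ℕ → Bool) (n : ℕ) (C : ℕ → ℕ → Bool) : Prop where
  clique : ∀ a < n, ∀ b < n, ∀ c < n, C a b = true → C a c = true → A b c = true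
  empty : ∀ a < n, ∀ b < n, C a a = false → C a b = false
  cover : ∀ K : Set ℕ, (∀ b ∈ K, b < n) → (∀ b ∈ K, ∀ c ∈ K, A b c = true) →
    (∃ b ∈ K, C b b = true) → ∃ a < n, ∀ b ∈ K, C a b = true

theorem visited_mono {i j : ℕ} (h : C i j = true) : visited A n a C i j = true := by
  unfold visited
  split_ifs
  · simp [recorded, h]
  · exact h

/-- The new row is the closed neighbourhood of `a` among the remaining vertices, a clique because
`a` is simplicial there. A clique that meets the eliminated vertices only after this step contains
`a` and otherwise only remaining neighbours of `a`, so it lies in the new row. -/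
theorem Eliminating.visited (hA : ∀ a < n, A a a = true) (ha : a < n) (h : Eliminating A n C) :
    Eliminating A n (visited A n a C) := by
  unfold Code.visited
  split_ifs with hv
  swap
  · exact h
  obtain ⟨h₀, hv⟩ := hv
  have hne : ∀ i j, i ≠ a → recorded A C n a i j = C i j := fun i j hi => by simp [recorded, hi]
  have hrow : ∀ j < n, recorded A C n a a j = (!C j j && A a j) := fun j hj => by
    simp [recorded, hj, h.empty a ha j hj h₀]
  refine ⟨fun i hi b hb c hc h₁ h₂ => ?_, fun i hi j hj hi' => ?_, fun K hK hc hk => ?_⟩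
  · by_cases hia : i = a
    · subst hia
      rw [hrow b hb] at h₁
      rw [hrow c hc] at h₂
      simp only [Bool.and_eq_true, Bool.not_eq_true'] at h₁ h₂
      by_contra hbc
      exact hv b hb c hc ⟨h₁.1, h₂.1, h₁.2, h₂.2, by simpa using hbc⟩
    · rw [hne _ _ hia] at h₁ h₂
      exact h.clique i hi b hb c hc h₁ h₂
  · by_cases hia : i = a
    · subst hia
      rw [hrow _ hi, h₀, hA _ hi] at hi'
      simp at hi'
    · rw [hne _ _ hia] at hi' ⊢
      exact h.empty i hi j hj hi'
  · by_cases hk' : ∃ b ∈ K, C b b = true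
    · obtain ⟨i, hi, hi'⟩ := h.cover K hK hc hk'
      exact ⟨i, hi, fun b hb => by simp [recorded, hi' b hb]⟩
    · push Not at hk'
      obtain ⟨b, hb, hb'⟩ := hk
      have hba : b = a := by
        by_contra hba
        rw [hne _ _ hba] at hb'
        exact hk' b hb hb'
      subst hba
      refine ⟨b, ha, fun c hc' => ?_⟩
      rw [hrow c (hK c hc')]
      simp [hc b hb c hc', hk' c hc']

/-- Eliminating other vertices keeps `a` simplicial, since a violation among fewer vertices is one
among more. So `a` is eliminated at its visit at the latest. -/
theorem Eliminating.pass (hA : ∀ a < n, A a a = true) (h : Eliminating A n C) (ha : a < n)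
    (hs : ∀ b < n, ∀ c < n, ¬ Violates A C a b c) :
    Eliminating A n (iter (Code.visited A n) C n) ∧
      (∀ i, C i i = true → iter (Code.visited A n) C n i i = true) ∧
      iter (Code.visited A n) C n a a = true := by
  have := iter_induction (f := Code.visited A n) (m := C) (n := n)
    (fun k (D : ℕ → ℕ → Bool) => Eliminating A n D ∧ (∀ i, C i i = true → D i i = true) ∧
      (a < k → D a a = true)) ⟨h, fun _ => id, by simp⟩ ?_
  · exact ⟨this.1, this.2.1, this.2.2 ha⟩
  rintro k hk D ⟨h₁, h₂, h₃⟩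
  refine ⟨h₁.visited hA hk, fun i hi => visited_mono (h₂ i hi), fun hak => ?_⟩
  obtain hak | rfl : a < k ∨ a = k := by omega
  · exact visited_mono (h₃ hak)
  · by_cases hD : D a a = true
    · exact visited_mono hD
    · have hD' : D a a = false := by simpa using hD
      have hc : ∀ i, D i i = false → C i i = false := fun i hi => by
        by_contra hC
        rw [h₂ i (by simpa using hC)] at hi
        exact absurd hi (by simp)
      unfold Code.visited
      rw [if_pos ⟨hD', fun b hb c hc' hv => hs b hb c hc' ⟨hc b hv.1, hc c hv.2.1, hv.2.2⟩⟩]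
      simp [recorded, hD', hA a ha, ha]

theorem count_lt_count {p q : ℕ → Bool} (h : ∀ i, p i = true → q i = true) (ha : a < n)
    (hp : p a = false) (hq : q a = true) : count n p < count n q := by
  refine Finset.card_lt_card ?_
  rw [Finset.ssubset_iff_of_subset (Finset.monotone_filter_right _ fun i _ => h i)]
  exact ⟨a, by simp [ha, hq], by simp [hp]⟩

/-- If each set of vertices contains a vertex that is simplicial in it, then the rows of the
result of the elimination are cliques, and each clique is contained in a row. -/
theorem eliminated_spec (hA : ∀ a < n, A a a = true)
    (hs : ∀ C : ℕ → ℕ → Bool, (∃ a < n, C a a = false) →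
      ∃ a < n, C a a = false ∧ ∀ b < n, ∀ c < n, ¬ Violates A C a b c) :
    (∀ a < n, ∀ b < n, ∀ c < n, eliminated A n n (fun _ _ => false) a b = true →
      eliminated A n n (fun _ _ => false) a c = true → A b c = true) ∧
    ∀ K : Set ℕ, K.Nonempty → (∀ b ∈ K, b < n) → (∀ b ∈ K, ∀ c ∈ K, A b c = true) →
      ∃ a < n, ∀ b ∈ K, eliminated A n n (fun _ _ => false) a b = true := by
  -- As long as some vertex remains, each pass eliminates at least one. A vertex remaining after `n`
  -- passes would force `n` eliminated vertices besides itself.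
  have := iter_induction (f := fun _ C => iter (visited A n) C n) (m := fun _ _ => false) (n := n)
    (fun k (D : ℕ → ℕ → Bool) => Eliminating A n D ∧
      ((∃ a < n, D a a = false) → k ≤ count n fun i => D i i)) ⟨⟨?_, ?_, ?_⟩, by simp⟩ ?_
  · obtain ⟨h₁, h₂⟩ := this
    refine ⟨h₁.clique, fun K ⟨b, hb⟩ hK hc => h₁.cover K hK hc ⟨b, hb, ?_⟩⟩
    by_contra hb'
    have hb' := eq_false_of_ne_true hb'
    have h₄ := count_lt_count (n := n) (p := fun i => eliminated A n n (fun _ _ => false) i i)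
      (q := fun _ => true) (fun _ _ => rfl) (hK b hb) hb' rfl
    exact absurd (h₂ ⟨b, hK b hb, hb'⟩) (not_le.2 (h₄.trans_le (count_le n _)))
  · simp
  · simp
  · simp
  · rintro k hk D ⟨h₁, h₂⟩
    by_cases hD : ∃ a < n, D a a = false
    · obtain ⟨a, ha, ha', hv⟩ := hs D hD
      obtain ⟨h₃, h₄, h₅⟩ := h₁.pass hA ha hv
      have := count_lt_count h₄ ha ha' h₅
      exact ⟨h₃, fun _ => (h₂ hD).trans_lt this⟩
    · have hD' : ∀ k ≤ n, iter (visited A n) D k = D := by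
        intro k hk
        refine iter_eq_self fun i hi => ?_
        unfold visited
        rw [if_neg fun h => hD ⟨i, by omega, h.1⟩]
      simp only [hD' n le_rfl]
      exact ⟨h₁, fun h => absurd h hD⟩

end Code
end StackProgram

/-! ### Chordal graphs: Dirac's theorem and covers by two cliques. -/

namespace VertexDeletion

open SimpleGraph

variable {V : Type} {G : SimpleGraph V}

/-- The edge replaces a segment of length at least two; this is why a shortest walk has no chords.
-/
theorem exists_shorter_walk {s t : V} (p : G.Walk s t) {i j : ℕ} (hij : i + 1 < j)
    (hj : j ≤ p.length) (h : G.Adj (p.getVert i) (p.getVert j)) :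
    ∃ q : G.Walk s t, q.length < p.length ∧ q.support ⊆ p.support := by
  refine ⟨(p.take i).append (.cons h (p.drop j)), ?_, ?_⟩
  · simp [Walk.length_append]
    omega
  · intro x hx
    rw [Walk.mem_support_append_iff, Walk.support_cons, List.mem_cons] at hx
    rcases hx with hx | rfl | hx
    · rw [Walk.support_take] at hx
      exact List.mem_of_mem_take hx
    · exact Walk.getVert_mem_support _ _
    · rw [Walk.drop_support_eq_support_drop_min] at hx
      exact List.mem_of_mem_drop hx

/-- In a chordal graph, two neighbours `s`, `t` of `v` are adjacent if they are joined by a walk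
whose other vertices are not adjacent to `v`. -/
theorem adj_of_walk (hG : chordal V G) {v s t : V} (hs : G.Adj v s) (ht : G.Adj v t) (hst : s ≠ t)
    {W : Set V} (hv : v ∉ W) (hW : ∀ x ∈ W, ¬ G.Adj v x) (p : G.Walk s t)
    (hp : ∀ x ∈ p.support, x ∈ W ∨ x = s ∨ x = t) : G.Adj s t := by
  classical
  by_contra hadj
  have hex : ∃ l, ∃ p : G.Walk s t, p.length = l ∧ ∀ x ∈ p.support, x ∈ W ∨ x = s ∨ x = t :=
    ⟨_, p, rfl, hp⟩
  obtain ⟨p₀, hl, hp₀⟩ := Nat.find_spec hex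
  have hmin : ∀ p : G.Walk s t, (∀ x ∈ p.support, x ∈ W ∨ x = s ∨ x = t) →
      Nat.find hex ≤ p.length := fun p hp => Nat.find_min' hex ⟨p, rfl, hp⟩
  -- `p₀` is a shortest admissible walk; bypassing makes it a path, no longer than before and with
  -- no new vertices.
  set q := p₀.bypass with hq
  have hqpath : q.IsPath := p₀.bypass_isPath
  have hqW : ∀ x ∈ q.support, x ∈ W ∨ x = s ∨ x = t :=
    fun x hx => hp₀ x (p₀.support_bypass_subset_support hx)
  have hql : q.length ≤ Nat.find hex := hl ▸ p₀.length_bypass_le_length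
  have hvq : v ∉ q.support := by
    intro h
    rcases hqW v h with h | rfl | rfl
    exacts [hv h, hs.ne rfl, ht.ne rfl]
  have hlen : 2 ≤ q.length := by
    by_contra h
    obtain h | h : q.length = 0 ∨ q.length = 1 := by omega
    · exact hst (Walk.eq_of_length_eq_zero h)
    · exact hadj (Walk.adj_of_length_eq_one h)
  -- As `s` and `t` are not adjacent, this cycle has length at least four. An edge from `v` to a
  -- vertex of `q` can only end in `s` or `t`, so it lies on the cycle; a chord between two vertices
  -- of `q` would shorten `q`.
  set c : G.Walk v v := .cons hs (q.concat ht.symm) with hc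
  have hedges : ∀ e, e ∈ c.edges ↔ e = s(v, s) ∨ e ∈ q.edges ∨ e = s(t, v) := by
    simp [hc, Walk.edges_concat]
  have hcyc : c.IsCycle := by
    rw [hc, Walk.cons_isCycle_iff]
    refine ⟨hqpath.concat hvq _, ?_⟩
    rw [Walk.edges_concat, List.concat_eq_append, List.mem_append, List.mem_singleton]
    rintro (h | h)
    · exact hvq (q.fst_mem_support_of_mem_edges h)
    · rw [Sym2.eq_swap, Sym2.eq_iff] at h
      rcases h with h | h
      · exact hst h.1
      · exact ht.ne h.2
  obtain ⟨e, he⟩ := hG v c hcyc (by simp [hc]; omega)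
  induction e with | _ x y
  obtain ⟨hxy, hnot, hx, hy⟩ := Walk.isChord_sym2Mk.1 he
  have hsupp : ∀ x, x ∈ c.support → x = v ∨ x ∈ q.support := by
    simp [hc, Walk.support_concat]
    tauto
  have hvx : ∀ x, G.Adj v x → x ∈ q.support → s(v, x) ∈ c.edges := by
    intro x hx hxq
    rcases hqW x hxq with h | rfl | rfl
    · exact absurd hx (hW x h)
    · exact (hedges _).2 (Or.inl rfl)
    · exact (hedges _).2 (Or.inr (Or.inr Sym2.eq_swap))
  have hqq : ∀ i j, i < j → j ≤ q.length → G.Adj (q.getVert i) (q.getVert j) →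
      s(q.getVert i, q.getVert j) ∈ c.edges := by
    intro i j hij hj h
    by_cases hij' : i + 1 = j
    · subst hij'
      refine (hedges _).2 (Or.inr (Or.inl ?_))
      rw [Walk.mk_mem_edges_iff_exists]
      exact ⟨i, by omega, rfl⟩
    · obtain ⟨q', hq', hsub⟩ := exists_shorter_walk q (by omega) hj h
      have := hmin q' fun x hx => hqW x (hsub hx)
      omega
  rcases hsupp x hx with rfl | hxq
  · rcases hsupp y hy with rfl | hyq
    · exact hxy.ne rfl
    · exact hnot (hvx y hxy hyq)
  · rcases hsupp y hy with rfl | hyq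
    · exact hnot (Sym2.eq_swap ▸ hvx x hxy.symm hxq)
    · obtain ⟨i, rfl, hi⟩ := Walk.mem_support_iff_exists_getVert.1 hxq
      obtain ⟨j, rfl, hj⟩ := Walk.mem_support_iff_exists_getVert.1 hyq
      rcases lt_trichotomy i j with h | rfl | h
      · exact hnot (hqq i j h hj hxy)
      · exact hxy.ne rfl
      · exact hnot (Sym2.eq_swap ▸ hqq j i h hi hxy.symm)

/-- `x` is simplicial in the subgraph induced by `R`. -/
def SimplicialIn (G : SimpleGraph V) (R : Set V) (x : V) : Prop :=
  ∀ y ∈ R, ∀ z ∈ R, G.Adj x y → G.Adj x z → y ≠ z → G.Adj y z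

/-- Chordal graphs have no induced cycles of length four. -/
theorem chordal.adj_or_adj (hG : chordal V G) {a b c d : V} (hab : G.Adj a b) (hbc : G.Adj b c)
    (hcd : G.Adj c d) (hda : G.Adj d a) (hac : a ≠ c) (hbd : b ≠ d) : G.Adj a c ∨ G.Adj b d := by
  by_contra! h
  refine h.2 (adj_of_walk hG hab hda.symm hbd (W := {c}) (by simpa using hac)
    (by simpa using h.1) (.cons hbc (.cons hcd .nil)) ?_)
  simp

/-- The graph with the edges of `G` inside `W`. -/
def within (G : SimpleGraph V) (W : Set V) : SimpleGraph V where
  Adj x y := G.Adj x y ∧ x ∈ W ∧ y ∈ W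
  symm := ⟨fun _ _ h => ⟨h.1.symm, h.2.2, h.2.1⟩⟩
  loopless := ⟨fun _ h => h.1.ne rfl⟩

theorem within_walk {W : Set V} {x y : V} (p : (within G W).Walk x y) (hx : x ∈ W) :
    ∃ q : G.Walk x y, ∀ z ∈ q.support, z ∈ W := by
  induction p with
  | nil => exact ⟨.nil, by simpa using hx⟩
  | cons h p ih =>
    obtain ⟨q, hq⟩ := ih h.2.2
    exact ⟨.cons h.1 q, by simpa using ⟨hx, hq⟩⟩

/-- The second statement strengthens the first to make the induction work. Given `v`, take a
component `C` of its non-neighbours in `R` and the boundary `S` of `C`. All of `S` is adjacent to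
`v`, and `S` is a clique by `adj_of_walk`, its members being joined through `C`. Neighbours in `R`
of vertices of `C` stay in `C ∪ S`, which misses `v`, so a vertex of `C` that is simplicial in `C ∪
S` is simplicial in `R`. -/
theorem exists_simplicialIn_aux (hG : chordal V G) (R : Finset V) :
    (R.Nonempty → ∃ x ∈ R, SimplicialIn G R x) ∧
    ∀ v ∈ R, (∃ y ∈ R, y ≠ v ∧ ¬ G.Adj v y) →
      ∃ x ∈ R, x ≠ v ∧ ¬ G.Adj v x ∧ SimplicialIn G R x := by
  classical
  induction R using Finset.strongInduction with
  | H R ih =>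
  have hB : ∀ v ∈ R, (∃ y ∈ R, y ≠ v ∧ ¬ G.Adj v y) →
      ∃ x ∈ R, x ≠ v ∧ ¬ G.Adj v x ∧ SimplicialIn G R x := by
    rintro v hv ⟨c₀, hc₀, hcv, hvc⟩
    set W : Set V := {x | x ∈ R ∧ x ≠ v ∧ ¬ G.Adj v x} with hW
    set C := R.filter fun x => (within G W).Reachable c₀ x with hC
    set S := R.filter fun x => x ∉ C ∧ ∃ y ∈ C, G.Adj x y with hS
    have hc₀W : c₀ ∈ W := ⟨hc₀, hcv, hvc⟩
    have hCW : ∀ x ∈ C, x ∈ W := by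
      intro x hx
      obtain ⟨p⟩ := (Finset.mem_filter.1 hx).2
      obtain ⟨q, hq⟩ := within_walk p hc₀W
      exact hq x q.end_mem_support
    have hc₀C : c₀ ∈ C := Finset.mem_filter.2 ⟨hc₀, .refl _⟩
    have hstep : ∀ x ∈ C, ∀ y ∈ R, G.Adj x y → y ∈ C ∨ y ∈ S := by
      intro x hx y hy hxy
      by_cases hyC : y ∈ C
      · exact Or.inl hyC
      · exact Or.inr (Finset.mem_filter.2 ⟨hy, hyC, x, hx, hxy.symm⟩)
    have hSv : ∀ s ∈ S, G.Adj v s := by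
      intro s hs
      obtain ⟨hsR, hsC, y, hy, hsy⟩ := Finset.mem_filter.1 hs
      by_contra hvs
      have hyW := hCW y hy
      have hsv : s ≠ v := by
        rintro rfl
        exact hyW.2.2 hsy
      refine hsC (Finset.mem_filter.2 ⟨hsR, (Finset.mem_filter.1 hy).2.trans ?_⟩)
      exact Adj.reachable (G := within G W) ⟨hsy.symm, hyW, hsR, hsv, hvs⟩
    have hSS : ∀ s ∈ S, ∀ t ∈ S, s ≠ t → G.Adj s t := by
      intro s hs t ht hst
      obtain ⟨hsR, hsC, a, ha, hsa⟩ := Finset.mem_filter.1 hs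
      obtain ⟨htR, htC, b, hb, htb⟩ := Finset.mem_filter.1 ht
      obtain ⟨p⟩ := (Finset.mem_filter.1 ha).2.symm.trans (Finset.mem_filter.1 hb).2
      obtain ⟨q, hq⟩ := within_walk p (hCW a ha)
      refine adj_of_walk hG (hSv s hs) (hSv t ht) hst (W := W) (fun h => h.2.1 rfl)
        (fun x hx => hx.2.2) (.cons hsa (q.concat htb.symm)) ?_
      intro x hx
      rw [Walk.support_cons, Walk.support_concat] at hx
      simp at hx
      rcases hx with rfl | hx | rfl
      · exact Or.inr (Or.inl rfl)
      · exact Or.inl (hq x hx)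
      · exact Or.inr (Or.inr rfl)
    have hlift : ∀ x ∈ C, SimplicialIn G (C ∪ S : Finset V) x → SimplicialIn G R x := by
      intro x hx h y hy z hz hxy hxz hyz
      exact h y (by simpa using hstep x hx y hy hxy) z (by simpa using hstep x hx z hz hxz)
        hxy hxz hyz
    suffices h : ∃ x ∈ C, SimplicialIn G (C ∪ S : Finset V) x by
      obtain ⟨x, hx, h⟩ := h
      exact ⟨x, (hCW x hx).1, (hCW x hx).2.1, (hCW x hx).2.2, hlift x hx h⟩
    have hvC : v ∉ C := fun h => (hCW v h).2.1 rfl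
    have hvS : v ∉ S := fun h => (hSv v h).ne rfl
    have hss : C ∪ S ⊂ R := by
      rw [Finset.ssubset_iff_of_subset (Finset.union_subset (Finset.filter_subset _ _)
        (Finset.filter_subset _ _))]
      exact ⟨v, hv, fun h => (Finset.mem_union.1 h).elim hvC hvS⟩
    -- If so, induction gives a simplicial vertex not adjacent to `s`, which lies in `C` because `S`
    -- is a clique. If not, every vertex of `S` is adjacent to all others of `C ∪ S`, and a
    -- simplicial vertex of `C` will do.
    by_cases hs : ∃ s ∈ S, ∃ y ∈ C ∪ S, y ≠ s ∧ ¬ G.Adj s y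
    · obtain ⟨s, hs, hy⟩ := hs
      obtain ⟨x, hx, hxs, hsx, hsimp⟩ := (ih _ hss).2 s (Finset.mem_union_right _ hs) hy
      refine ⟨x, (Finset.mem_union.1 hx).resolve_right fun hxS => ?_, hsimp⟩
      exact hsx (hSS s hs x hxS hxs.symm)
    · push Not at hs
      obtain ⟨x, hx, h⟩ := (ih C ((Finset.subset_union_left).trans_ssubset hss)).1 ⟨c₀, hc₀C⟩
      refine ⟨x, hx, fun y hy z hz hxy hxz hyz => ?_⟩
      rcases Finset.mem_union.1 hy with hyC | hyS
      · rcases Finset.mem_union.1 hz with hzC | hzS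
        · exact h y hyC z hzC hxy hxz hyz
        · exact (hs z hzS y hy hyz).symm
      · exact hs y hyS z hz hyz.symm
  refine ⟨fun ⟨x, hx⟩ => ?_, hB⟩
  by_cases h : ∃ v ∈ R, ∃ y ∈ R, y ≠ v ∧ ¬ G.Adj v y
  · obtain ⟨v, hv, hy⟩ := h
    obtain ⟨x, hx, -, -, h⟩ := hB v hv hy
    exact ⟨x, hx, h⟩
  · push Not at h
    exact ⟨x, hx, fun y hy z hz _ _ hyz => h y hy z hz hyz.symm⟩

/-- Dirac's theorem: every set of vertices of a chordal graph contains a vertex that is simplicial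
in it. -/
theorem exists_simplicialIn (hG : chordal V G) {R : Finset V} (hR : R.Nonempty) :
    ∃ x ∈ R, SimplicialIn G R x :=
  (exists_simplicialIn_aux hG R).1 hR

/-- A vertex set of a chordal graph is a deletion set to co-chain graphs if and only if two cliques
cover its complement. -/
theorem isDeletionSet_coChain_iff (hG : chordal V G) {X : Finset V} :
    IsDeletionSet coChain G X ↔
      ∃ K L : Set V, G.IsClique K ∧ G.IsClique L ∧ (X : Set V)ᶜ = K ∪ L := by
  constructor
  · rintro ⟨A, B, hAB, hbip, -⟩
    have key : ∀ A B : Set ((X : Set V)ᶜ : Set V),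
        (G.induce ((X : Set V)ᶜ))ᶜ.IsBipartiteWith A B → G.IsClique (Subtype.val '' A) := by
      rintro A B hbip _ ⟨x, hx, rfl⟩ _ ⟨y, hy, rfl⟩ hxy
      by_contra hadj
      have hne : x ≠ y := fun h => hxy (congrArg _ h)
      rcases hbip.mem_of_adj (v := x) (w := y) (by simpa [hne] using hadj) with h | h
      · exact Set.disjoint_left.1 hbip.disjoint hy h.2
      · exact Set.disjoint_left.1 hbip.disjoint hx h.1
    refine ⟨_, _, key A B hbip, key B A hbip.symm, ?_⟩
    rw [← Set.image_union, hAB, Set.image_univ, Subtype.range_coe]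
  · rintro ⟨K, L, hK, hL, hX⟩
    have hKL : ∀ x : ((X : Set V)ᶜ : Set V), x.1 ∈ K ∨ x.1 ∈ L := fun x => hX.subset x.2
    -- `K` and `L` may overlap; the common vertices go to the side of `K`.
    refine ⟨{x | x.1 ∈ K}, {x | x.1 ∉ K}, ?_, ⟨?_, ?_⟩, ?_⟩
    · ext x
      simpa using em _
    · rw [Set.disjoint_left]
      exact fun x h h' => h' h
    · rintro x y hxy
      have hxL := hKL x
      have hyL := hKL y
      have hne : x.1 ≠ y.1 := fun h => hxy.ne (Subtype.ext h)
      have hadj : ¬ G.Adj x.1 y.1 := fun h => by simp [h] at hxy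
      by_cases hx : x.1 ∈ K <;> by_cases hy : y.1 ∈ K
      · exact absurd (hK hx hy hne) hadj
      · exact Or.inl ⟨hx, hy⟩
      · exact Or.inr ⟨hx, hy⟩
      · exact absurd (hL (hxL.resolve_left hx) (hyL.resolve_left hy) hne) hadj
    · rintro _ ⟨a, ha, rfl⟩ _ ⟨a', ha', rfl⟩ -
      by_contra! h
      obtain ⟨b, hb, hb'⟩ := Set.not_subset.1 h.1
      obtain ⟨c, hc, hc'⟩ := Set.not_subset.1 h.2
      have key : ∀ x y z : ((X : Set V)ᶜ : Set V), x.1 ∈ K → z.1 ∈ K →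
          y ∈ (G.induce ((X : Set V)ᶜ))ᶜ.neighborSet x →
          y ∉ (G.induce ((X : Set V)ᶜ))ᶜ.neighborSet z →
          x.1 ≠ y.1 ∧ ¬ G.Adj x.1 y.1 ∧ y.1 ∈ L ∧ G.Adj z.1 y.1 := by
        intro x y z hx hz (hxy : (G.induce ((X : Set V)ᶜ))ᶜ.Adj x y) hzy
        have hne : x.1 ≠ y.1 := fun h => hxy.ne (Subtype.ext h)
        have hadj : ¬ G.Adj x.1 y.1 := fun h => by simp [h] at hxy
        have hy : y.1 ∉ K := fun hy => hadj (hK hx hy hne)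
        refine ⟨hne, hadj, (hKL y).resolve_left hy, ?_⟩
        by_contra hzy'
        refine hzy ⟨?_, hzy'⟩
        rintro rfl
        exact hy hz
      obtain ⟨hab, h₁, h₂, h₃⟩ := key a b a' ha ha' hb hb'
      obtain ⟨hac, h₄, h₅, h₆⟩ := key a' c a ha' ha hc hc'
      have haa : a.1 ≠ a'.1 := fun h => h₁ (h ▸ h₃)
      have hbc : b.1 ≠ c.1 := fun h => h₁ (h ▸ h₆)
      -- The four-cycle is `a`, `a'`, `b`, `c`; both of its diagonals, `ab` and `a'c`, are
      -- non-edges.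
      exact (hG.adj_or_adj (hK ha ha' haa) h₃ (hL h₂ h₅ hbc) h₆.symm
        hab hac).elim h₁ h₄

end VertexDeletion

/-! ### Correctness of the algorithm on chordal graphs. -/

namespace VertexDeletion

open SimpleGraph StackProgram StackProgram.Code

variable {n : ℕ} {G : SimpleGraph (Fin n)}

open scoped Classical in
/-- The adjacency matrix, indexed by natural numbers. -/
noncomputable def matrix (G : SimpleGraph (Fin n)) (i j : ℕ) : Bool :=
  decide (∃ (hi : i < n) (hj : j < n), G.Adj ⟨i, hi⟩ ⟨j, hj⟩)

/-- The result of the elimination. -/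
noncomputable def cliques (G : SimpleGraph (Fin n)) : ℕ → ℕ → Bool :=
  eliminated (closed (matrix G) n) n n fun _ _ => false

/-- The result of the algorithm. -/
noncomputable def solution (G : SimpleGraph (Fin n)) : ℕ → ℕ → Bool :=
  optimised (cliques G) n fun _ _ => true

/-- The vertex set found by the algorithm. -/
noncomputable def solutionSet (G : SimpleGraph (Fin n)) : Finset (Fin n) :=
  Finset.univ.filter fun w => solution G w w = true

theorem card_filter_fin (p : ℕ → Bool) :
    (Finset.univ.filter fun w : Fin n => p w = true).card = count n p := by
  rw [count, ← Finset.card_map Fin.valEmbedding]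
  congr 1
  ext w
  simp only [Finset.mem_map, Finset.mem_filter, Finset.mem_univ, true_and, Finset.mem_range,
    Fin.valEmbedding_apply]
  constructor
  · rintro ⟨i, hi, rfl⟩
    exact ⟨i.2, hi⟩
  · rintro ⟨hw, h⟩
    exact ⟨⟨w, hw⟩, h, rfl⟩

theorem closed_matrix_iff {i j : ℕ} (hi : i < n) (hj : j < n) :
    closed (matrix G) n i j = true ↔ i = j ∨ G.Adj ⟨i, hi⟩ ⟨j, hj⟩ := by
  by_cases h : i = j <;> simp [closed, matrix, h, hi, hj]

/-- Dirac's theorem, applied to the set of vertices not yet eliminated, supplies the hypothesis of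
`eliminated_spec`. -/
theorem cliques_spec (hG : chordal (Fin n) G) :
    (∀ a < n, G.IsClique {w | cliques G a w = true}) ∧
    ∀ K : Set (Fin n), K.Nonempty → G.IsClique K → ∃ a < n, ∀ w ∈ K, cliques G a w = true := by
  have h := eliminated_spec (A := closed (matrix G) n) (n := n)
    (fun a ha => (closed_matrix_iff ha ha).2 (Or.inl rfl)) ?_
  · obtain ⟨h₁, h₂⟩ := h
    refine ⟨fun a ha x hx y hy hxy => ?_, fun K ⟨x, hx⟩ hK => ?_⟩
    · exact ((closed_matrix_iff x.2 y.2).1 (h₁ a ha x x.2 y y.2 hx hy)).resolve_left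
        fun h => hxy (Fin.ext h)
    · have h := h₂ (Fin.val '' K) ⟨x, x, hx, rfl⟩ ?_ ?_
      · obtain ⟨a, ha, h⟩ := h
        exact ⟨a, ha, fun w hw => h w ⟨w, hw, rfl⟩⟩
      · rintro _ ⟨x, -, rfl⟩
        exact x.2
      · rintro _ ⟨x, hx, rfl⟩ _ ⟨y, hy, rfl⟩
        rw [closed_matrix_iff x.2 y.2]
        by_cases hxy : x = y
        · exact Or.inl (congrArg _ hxy)
        · exact Or.inr (hK hx hy hxy)
  · rintro C ⟨a, ha, haC⟩
    obtain ⟨x, hx, hs⟩ := exists_simplicialIn hG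
      (R := Finset.univ.filter fun x : Fin n => C x x = false) ⟨⟨a, ha⟩, by simpa using haC⟩
    refine ⟨x, x.2, by simpa using hx, fun b hb c hc ⟨hbC, hcC, hxb, hxc, hbc⟩ => ?_⟩
    have hbc' := mt (closed_matrix_iff (G := G) hb hc).2 (by simp [hbc])
    rw [not_or] at hbc'
    -- The matrix is reflexive, so `x = b` and `x = c` have to be excluded: either would make `b`
    -- and `c` adjacent.
    rcases (closed_matrix_iff x.2 hb).1 hxb with h | h
    · rw [← h, hxc] at hbc
      simp at hbc
    rcases (closed_matrix_iff x.2 hc).1 hxc with h' | h'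
    · exact hbc'.2 (by simpa [← h'] using h.symm)
    · exact hbc'.2 (hs ⟨b, hb⟩ (by simpa using hbC) ⟨c, hc⟩ (by simpa using hcC) h h'
        fun e => hbc'.1 (congrArg Fin.val e))

/-- For any other deletion set `Y`, the two cliques covering its complement lie in rows `a` and `b`,
so the vertices outside these rows belong to `Y`, and there are at least as many of them as in the
solution. -/
theorem isMinimumDeletionSet_solutionSet (hG : chordal (Fin n) G) :
    IsMinimumDeletionSet coChain G (solutionSet G) := by
  obtain ⟨hrow, hcover⟩ := cliques_spec hG
  obtain ⟨hsol, hmin⟩ := optimised_spec (cliques G) n (S := fun _ _ => true) fun _ _ => rfl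
  refine ⟨(isDeletionSet_coChain_iff hG).2 ?_, fun Y hY => ?_⟩
  · rcases hsol with h | ⟨a, ha, b, hb, h⟩
    · refine ⟨∅, ∅, by simp, by simp, ?_⟩
      ext w
      have := h w w.2
      change solution G w w = _ at this
      simp [solutionSet, this]
    · refine ⟨_, _, hrow a ha, hrow b hb, ?_⟩
      ext w
      have := h w w.2
      change solution G w w = _ at this
      rw [outside] at this
      cases ha' : cliques G a w <;> cases hb' : cliques G b w <;>
        simp [solutionSet, this, ha', hb']
  · obtain ⟨K, L, hK, hL, hY⟩ := (isDeletionSet_coChain_iff hG).1 hY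
    rw [solutionSet, card_filter_fin fun w => solution G w w]
    -- An empty clique is assigned row 0, which exists only for `n > 0`.
    rcases Nat.eq_zero_or_pos n with h₀ | h₀
    · have := count_le n fun w => solution G w w
      omega
    have hc : ∀ K : Set (Fin n), G.IsClique K → ∃ a < n, ∀ w ∈ K, cliques G a w = true := by
      intro K hK
      rcases K.eq_empty_or_nonempty with rfl | h
      · exact ⟨0, h₀, by simp⟩
      · exact hcover K h hK
    obtain ⟨a, ha, hKa⟩ := hc K hK
    obtain ⟨b, hb, hLb⟩ := hc L hL
    refine (hmin a ha b hb).trans ?_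
    rw [← card_filter_fin]
    refine Finset.card_le_card fun w hw => ?_
    by_contra hwY
    have hw' : w ∈ K ∪ L := hY ▸ hwY
    simp only [outside] at hw
    rcases hw' with h | h
    · simp [hKa w h] at hw
    · simp [hLb w h] at hw

end VertexDeletion

/-! ### Reading the input and cleaning up the stacks. -/

namespace StackProgram

open Function (update)

/-- The stacks of the algorithm. -/
abbrev Stack : Type := Cell Index Table Buffer

namespace Prog

open Index Table Buffer

variable {I : Type} {d : I → Sym} {r : Reg} {i : List I} {n : ℕ}

/-- Empty all stacks but one. -/
noncomputable def finish {κ : Type} [Fintype κ] [DecidableEq κ] (out : κ) : Prog κ :=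
  clearAll (Finset.univ.erase out).toList

theorem runs_finish {κ : Type} [Fintype κ] [DecidableEq κ] (out : κ) {B : ℕ} {S : κ → List Bool}
    (hS : ∀ c, (S c).length ≤ B) (r : Reg) (i : List I) :
    ∃ r', Runs d (finish out) ⟨r, i, S⟩ ⟨r', i, update (fun _ => []) out (S out)⟩
      (Fintype.card κ * (3 * B + 2) + 1) := by
  obtain ⟨r', h⟩ := runs_clearAll (d := d) (Finset.univ.erase out).toList r i S
  refine ⟨r', (h.of_eq rfl ?_).mono ?_⟩
  · funext c
    by_cases hc : c = out
    · subst hc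
      simp
    · simp [hc]
  · have h₁ : ((Finset.univ.erase out).toList.map fun a => (S a).length).sum ≤
        (Finset.univ.erase out).toList.length * B := by
      have := List.sum_le_card_nsmul ((Finset.univ.erase out).toList.map fun a => (S a).length) B
        (by simpa using fun a _ => hS a)
      simpa using this
    have h₂ : (Finset.univ.erase out).toList.length ≤ Fintype.card κ := by
      rw [Finset.length_toList]
      exact Finset.card_le_univ _
    have h₃ : (Finset.univ.erase out).toList.length * (3 * B + 2) ≤
        Fintype.card κ * (3 * B + 2) := Nat.mul_le_mul_right _ h₂
    nlinarith

/-- The entry of the adjacency matrix in the register. -/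
def matrixBit (r : Reg) : Bool := decide (r = some (Sum.inl (some true)))

/-- Distribute an input symbol to the stacks. -/
def store : Prog Stack :=
  ite (fun r => decide (r = some (Sum.inl none))) (push .size fun _ => true) <|
    ite (fun r => decide (r = some (Sum.inl (some true)) ∨ r = some (Sum.inl (some false))))
      (seq (push (.buf matrix) matrixBit)
        -- One bit per matrix entry gives these arrays their `n * n` entries without any
        -- multiplication.
        (seq (push (.arr clique) fun _ => false) (push (.arr sol) fun _ => true)))
      (push (.buf revNum) bit)

/-- Read the input. -/
def readAll : Prog Stack := seq read (loop Option.isSome (seq store read))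

/-- The matrix entries in the input. -/
def matrixPart (l : List Sym) : List Bool := l.filterMap fun a => a.elim id fun _ => none

/-- The binary number in the input. -/
def numPart (l : List Sym) : List Bool := l.filterMap Sum.getRight?

/-- The number of rows in the input. -/
def rows (l : List Sym) : ℕ := l.count (Sum.inl none)

section
variable (b : Bool) (l : List Sym)

@[simp] theorem rows_none : rows (Sum.inl none :: l) = rows l + 1 := by
  rw [rows, List.count_cons]; rfl
@[simp] theorem rows_some : rows (Sum.inl (some b) :: l) = rows l := by
  rw [rows, List.count_cons]; rfl
@[simp] theorem rows_inr : rows (Sum.inr b :: l) = rows l := by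
  rw [rows, List.count_cons]; rfl
@[simp] theorem matrixPart_none : matrixPart (Sum.inl none :: l) = matrixPart l := rfl
@[simp] theorem matrixPart_some : matrixPart (Sum.inl (some b) :: l) = b :: matrixPart l := rfl
@[simp] theorem matrixPart_inr : matrixPart (Sum.inr b :: l) = matrixPart l := rfl
@[simp] theorem numPart_inl (o : Option Bool) : numPart (Sum.inl o :: l) = numPart l := rfl
@[simp] theorem numPart_inr : numPart (Sum.inr b :: l) = b :: numPart l := rfl

@[simp] theorem rows_nil : rows [] = 0 := rfl
@[simp] theorem matrixPart_nil : matrixPart [] = [] := rfl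
@[simp] theorem numPart_nil : numPart [] = [] := rfl

end

/-- The contents of the stacks after reading the input `l`. -/
def loaded (l : List Sym) (S : Stack → List Bool) : Stack → List Bool
  | .size => List.replicate (rows l) true ++ S .size
  | .buf matrix => (matrixPart l).reverse ++ S (.buf matrix)
  | .arr clique => List.replicate (matrixPart l).length false ++ S (.arr clique)
  | .arr sol => List.replicate (matrixPart l).length true ++ S (.arr sol)
  | .buf revNum => (numPart l).reverse ++ S (.buf revNum)
  | c => S c

/-- `loaded` acts as an accumulator: storing the first symbol and then loading the rest amounts to
loading everything, which is the induction step for `runs_readAll`. -/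
theorem runs_store (a : Sym) (i : List I) (S : Stack → List Bool) :
    ∃ S', (∀ l, loaded l S' = loaded (a :: l) S) ∧
      Runs d store ⟨some a, i, S⟩ ⟨some a, i, S'⟩ 5 := by
  rcases a with _ | b
  · rename_i o
    rcases o with _ | b
    · refine ⟨_, fun l => ?_, ((runs_push _ _ _ _ _).ite_true (by simp)).mono (by omega)⟩
      funext c
      rcases c with _ | x | x | a | z | j
      · simp [loaded, List.replicate_succ']
      · simp [loaded]
      · simp [loaded]
      · cases a <;> simp [loaded]
      · cases z <;> simp [loaded]
      · simp [loaded]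
    · refine ⟨_, fun l => ?_, ((((runs_push _ _ _ _ _).seq ((runs_push _ _ _ _ _).seq
        (runs_push _ _ _ _ _))).ite_true (by cases b <;> simp)).ite_false (by simp)).mono (by omega)⟩
      funext c
      rcases c with _ | x | x | a | z | j
      · simp [loaded]
      · simp [loaded]
      · simp [loaded]
      · cases a <;> simp [loaded, List.replicate_succ']
      · cases z <;> simp [loaded, matrixBit]
      · simp [loaded]
  · refine ⟨_, fun l => ?_, (((runs_push _ _ _ _ _).ite_false (by simp)).ite_false
      (by simp)).mono (by omega)⟩
    funext c
    rcases c with _ | x | x | a | z | j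
    · simp [loaded]
    · simp [loaded]
    · simp [loaded]
    · cases a <;> simp [loaded]
    · cases z <;> simp [loaded]
    · simp [loaded]

theorem runs_readAll (r : Reg) (i : List I) (S : Stack → List Bool) :
    Runs d readAll ⟨r, i, S⟩ ⟨none, [], loaded (i.map d) S⟩ (7 * i.length + 2) := by
  have key : ∀ (i : List I) (S : Stack → List Bool),
      Runs d (loop Option.isSome (seq store read)) ⟨i.head?.map d, i.tail, S⟩
        ⟨none, [], loaded (i.map d) S⟩ (7 * i.length + 1) := by
    intro i
    induction i with
    | nil =>
      intro S
      have : loaded [] S = S := by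
        funext c
        rcases c with _ | x | x | a | z | j
        · simp [loaded]
        · simp [loaded]
        · simp [loaded]
        · cases a <;> simp [loaded]
        · cases z <;> simp [loaded]
        · simp [loaded]
      rw [List.map_nil, this]
      exact runs_loop_false rfl
    | cons a i ih =>
      intro S
      obtain ⟨S', hS', h⟩ := runs_store (d := d) (d a) i S
      rw [List.map_cons, ← hS']
      refine (Runs.loop_true (by rfl) (h.seq (runs_read _ _ _)) (ih S')).mono ?_
      simp
      omega
  exact ((runs_read r i S).seq (key i S)).mono (by omega)

/-- Read the input and turn it into a memory. -/
def prepare : Prog Stack :=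
  -- Reading reverses the matrix and the number, and the moves reverse them back.
  seq readAll (seq (move (.buf matrix) (.arr adj)) (move (.buf revNum) (.buf num)))

end Prog

/-- The memory at the beginning of the algorithm. -/
def initial (A : ℕ → ℕ → Bool) (l : List Bool) : Memory where
  arr
    | .adj => A
    | .clique => fun _ _ => false
    -- Deleting all vertices is always a solution, so the search for improvements starts from it.
    | .sol => fun _ _ => true
  buf
    | .num => l
    | _ => []

theorem arrayList_const (n : ℕ) (b : Bool) :
    arrayList n (fun _ _ => b) = List.replicate (n * n) b := by
  simp [arrayList]

namespace Prog

open Index Table Buffer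

variable {I : Type} {d : I → Sym} {i : List I} {n : ℕ} {A : ℕ → ℕ → Bool} {l : List Bool}

theorem runs_prepare (h₁ : rows (i.map d) = n) (h₂ : matrixPart (i.map d) = arrayList n A)
    (h₃ : numPart (i.map d) = l) :
    Runs d prepare ⟨none, i, fun _ => []⟩ ⟨none, [], rep n (fun _ => none) (initial A l)⟩
      (7 * i.length + 3 * (n * n) + 3 * l.length + 6) := by
  refine (((runs_readAll none i _).seq ((runs_move (by simp) _ _ _).seq
    (runs_move (by simp) _ _ _))).of_eq rfl ?_).mono ?_
  · funext c
    rcases c with _ | x | x | a | z | j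
    · simp [loaded, rep, h₁]
    · simp [loaded, rep]
    · simp [loaded, rep]
    · cases a <;> simp [loaded, rep, h₂, initial, arrayList_const]
    · cases z <;> simp [loaded, rep, h₃, initial]
    · simp [loaded, rep]
  · simp [loaded, h₂, h₃]
    omega

end Prog
end StackProgram

/-! ### Comparing a unary with a binary number; from programs to polynomial-time machines. -/

namespace StackProgram

open Function (update)

/-- The number whose binary digits, starting with the least significant one, are `l`. -/
def value (l : List Bool) : ℕ := l.foldr (fun b v => b.toNat + 2 * v) 0

/-- Subtract each digit in turn, and halve, rounding up. -/
def reduce (l : List Bool) (u : ℕ) : ℕ := l.foldl (fun u b => (u - b.toNat + 1) / 2) u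

/-- For a lowest digit `b` and the value `v` of the others, `u ≤ b + 2 * v` holds if and only if
`⌈(u - b) / 2⌉ ≤ v`. -/
theorem reduce_eq_zero_iff (l : List Bool) (u : ℕ) : reduce l u = 0 ↔ u ≤ value l := by
  induction l generalizing u with
  | nil => simp [reduce, value]
  | cons b l ih =>
    have := ih ((u - b.toNat + 1) / 2)
    simp only [reduce, value, List.foldl_cons, List.foldr_cons] at this ⊢
    rw [this]
    omega

theorem reduce_le (l : List Bool) (u : ℕ) : reduce l u ≤ u := by
  induction l generalizing u with
  | nil => simp [reduce]
  | cons b l ih =>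
    have := ih ((u - b.toNat + 1) / 2)
    simp only [reduce, List.foldl_cons] at this ⊢
    omega

theorem value_encodePosNum (k : PosNum) : value (Computability.encodePosNum k) = k := by
  induction k with
  | one => rfl
  | bit0 k ih =>
    simp only [value] at ih
    simp [Computability.encodePosNum, value, ih]
    omega
  | bit1 k ih =>
    simp only [value] at ih
    simp [Computability.encodePosNum, value, ih]
    omega

theorem value_encodeNat (k : ℕ) : value (Computability.encodeNat k) = k := by
  have h : ∀ m : Num, value (Computability.encodeNum m) = m := by
    rintro (_ | m)
    · rfl
    · exact value_encodePosNum m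
  exact (h k).trans (Num.to_of_nat k)

namespace Prog

section

variable {κ I : Type} [DecidableEq κ] {d : I → Sym} {r : Reg} {i : List I} {S : κ → List Bool}

/-- Halve the number of bits on the stack `a`, rounding up, using the empty stack `b`. -/
def halve (a b : κ) : Prog κ :=
  seq (seq (pop a) (loop Option.isSome (seq (push b fun _ => true) (seq (pop a) (pop a)))))
    (move b a)

theorem runs_halve {a b : κ} (hab : a ≠ b) {t : ℕ} (ha : S a = List.replicate t true)
    (hb : S b = []) (r : Reg) (i : List I) :
    Runs d (halve a b) ⟨r, i, S⟩ ⟨none, i, update S a (List.replicate ((t + 1) / 2) true)⟩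
      (7 * t + 4) := by
  have key : ∀ t h, Runs d (loop Option.isSome (seq (push b fun _ => true) (seq (pop a) (pop a))))
      ⟨(List.replicate t true).head?.map Sum.inr, i,
        update (update S a (List.replicate t true).tail) b (List.replicate h true)⟩
      ⟨none, i, update (update S a []) b (List.replicate (h + (t + 1) / 2) true)⟩ (4 * t + 1) := by
    intro t
    induction t using Nat.strong_induction_on with
    | _ t ih =>
      intro h
      rcases t with _ | t
      · simpa using runs_loop_false rfl
      -- A round uses up the bit in the register and one more. If there is no second bit, the pops
      -- find an empty stack and `t - 1` truncates to 0; this is the rounding up.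
      · have h₁ := ih (t - 1) (by omega) (h + 1)
        have h₂ : Runs d (seq (push b fun _ => true) (seq (pop a) (pop a)))
            ⟨(List.replicate (t + 1) true).head?.map Sum.inr, i,
              update (update S a (List.replicate (t + 1) true).tail) b (List.replicate h true)⟩
            ⟨(List.replicate (t - 1) true).head?.map Sum.inr, i, update (update S a
              (List.replicate (t - 1) true).tail) b (List.replicate (h + 1) true)⟩ 3 := by
          convert (runs_push b (fun _ => true) _ i _).seq ((runs_pop a _ i _).seq (runs_pop a _ i _))
            using 2
          · simp [hab]
          · funext c
            simp only [Function.update_apply]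
            split_ifs <;> simp_all [List.replicate_succ]
        have e : h + 1 + (t - 1 + 1) / 2 = h + (t + 1 + 1) / 2 := by omega
        rw [e] at h₁
        exact (Runs.loop_true (by simp [List.replicate_succ]) h₂ h₁).mono (by omega)
  have h₁ := runs_pop (d := d) a r i S
  have h₂ := key t 0
  rw [ha] at h₁
  have h₃ := runs_move (d := d) hab.symm none i
    (update (update S a []) b (List.replicate (0 + (t + 1) / 2) true))
  refine (((h₁.seq (h₂.of_eq ?_ rfl)).seq h₃).of_eq rfl ?_).mono ?_
  · funext c
    simp only [Function.update_apply]
    split_ifs <;> simp_all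
  · funext c
    simp only [Function.update_apply]
    split_ifs <;> simp_all
  · simp
    omega

/-- Reduce the number of bits on the stack `a` by the digits on the stack `l`. -/
def compare (l a b : κ) : Prog κ := drain l (seq (ite bit (pop a) nop) (halve a b))

/-- Writing the binary number in unary could take exponential time; here the unary number is shrunk
instead, and by `reduce_le` it never exceeds `t`, which bounds each round. -/
theorem runs_compare {l a b : κ} (hla : l ≠ a) (hlb : l ≠ b) (hab : a ≠ b) {t : ℕ}
    (ha : S a = List.replicate t true) (hb : S b = []) (r : Reg) (i : List I) :
    Runs d (compare l a b) ⟨r, i, S⟩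
      ⟨none, i, update (update S l []) a (List.replicate (reduce (S l) t) true)⟩
      ((7 * t + 8) * (S l).length + 2) := by
  refine (runs_drain (d := d) (k := l) (i := i) (T := 7 * t + 6) (S l)
    (fun j => update (update S l ((S l).drop j)) a
      (List.replicate (reduce ((S l).take j) t) true)) ?_ ?_ r).of_eq ?_ ?_
  · intro j hj
    simp [hla]
  · intro j hj
    have hu := reduce_le ((S l).take j) t
    have e : reduce ((S l).take (j + 1)) t = (reduce ((S l).take j) t - (S l)[j].toNat + 1) / 2 := by
      rw [List.take_succ_eq_append_getElem hj, reduce, List.foldl_append]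
      rfl
    rw [e]
    generalize reduce ((S l).take j) t = u at hu
    have h₁ : ∃ r', Runs d (ite bit (pop a) nop) ⟨some (Sum.inr (S l)[j]), i, update
        (update (update S l ((S l).drop j)) a (List.replicate u true)) l ((S l).drop (j + 1))⟩
        ⟨r', i, update (update S l ((S l).drop (j + 1))) a
          (List.replicate (u - (S l)[j].toNat) true)⟩ 2 := by
      by_cases hbit : (S l)[j] = true
      · refine ⟨_, ((runs_pop a _ i _).ite_true (by simp [hbit])).of_eq rfl ?_⟩
        funext c
        rw [hbit]
        simp only [Function.update_apply]
        split_ifs <;> simp_all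
      · refine ⟨_, (runs_nop.ite_false (by simp [hbit])).of_eq rfl ?_⟩
        simp only [Bool.not_eq_true] at hbit
        funext c
        rw [hbit]
        simp only [Function.update_apply]
        split_ifs <;> simp_all
    obtain ⟨r', h₁⟩ := h₁
    refine ⟨none, ((h₁.seq (runs_halve hab (t := u - (S l)[j].toNat) ?_ ?_ r' i)).of_eq rfl
      ?_).mono ?_⟩
    · simp
    · simp [hab.symm, hlb.symm, hb]
    · simp
    · omega
  · funext c
    simp only [Function.update_apply]
    split_ifs <;> simp_all [reduce]
  · simp

end

/-- A program that takes polynomial time gives a polynomial-time Turing machine. -/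
theorem computableInPolyTime {κ Γ α β : Type} [Fintype κ] [DecidableEq κ] [Fintype Γ]
    {ea : α → List Γ} {eb : β → List Bool} {f : α → β} (d : Γ → Sym) (p : Prog κ) (out : κ)
    (T : Polynomial ℕ) (h : ∀ a, ∃ r, Runs d p ⟨none, ea a, fun _ => []⟩
      ⟨r, [], update (fun _ => []) out (eb (f a))⟩ (T.eval (ea a).length)) :
    Nonempty (Turing.TM2ComputableInPolyTime ea eb f) := by
  have h' : ∀ a, Nonempty (Turing.TM2OutputsInTime (machine d p out) (ea a) (some (eb (f a)))
      ((T + 1).eval (ea a).length)) := by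
    intro a
    obtain ⟨r, h⟩ := h a
    rw [Polynomial.eval_add, Polynomial.eval_one]
    exact h.outputs rfl rfl
  refine ⟨⟨⟨machine d p out, Equiv.refl _, Equiv.refl _⟩, T + 1, fun a => ?_⟩⟩
  have key : ∀ {M : Turing.FinTM2} {l l' : List (M.Γ M.k₀)} {w w' : List (M.Γ M.k₁)} {t : ℕ},
      l = l' → w = w' → Turing.TM2OutputsInTime M l (some w) t →
      Turing.TM2OutputsInTime M l' (some w') t := fun e₁ e₂ h => e₁ ▸ e₂ ▸ h
  exact key (List.map_id (ea a)).symm (List.map_id (eb (f a))).symm (h' a).some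

end Prog

/-- Used to turn time bounds in `n` into bounds in the input length. -/
theorem eval_mono (p : Polynomial ℕ) {a b : ℕ} (h : a ≤ b) : p.eval a ≤ p.eval b := by
  rw [Polynomial.eval_eq_sum, Polynomial.eval_eq_sum]
  exact Finset.sum_le_sum fun k _ => Nat.mul_le_mul_left _ (Nat.pow_le_pow_left h k)

end StackProgram

/-! ### Decoding the input, and the two machines. -/

namespace VertexDeletion

open StackProgram StackProgram.Prog StackProgram.Code Function

variable {n : ℕ} {G : SimpleGraph (Fin n)}

theorem arrayList_eq_flatMap (n : ℕ) (A : ℕ → ℕ → Bool) :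
    arrayList n A = (List.finRange n).flatMap fun i : Fin n =>
      (List.finRange n).map fun j : Fin n => A i j := by
  have key : ∀ m, (List.range (m * n)).map (fun p => A (p / n) (p % n)) =
      (List.range m).flatMap fun i => (List.range n).map fun j => A i j := by
    intro m
    induction m with
    | zero => simp
    | succ m ih =>
      rw [Nat.succ_mul, List.range_add, List.map_append, ih, List.range_succ, List.flatMap_append]
      congr 1
      simp only [List.map_map, List.flatMap_singleton]
      refine List.map_congr_left fun j hj => ?_
      have hj := List.mem_range.1 hj
      simp only [comp_apply]
      rw [mul_comm m, Nat.mul_add_div (by omega), Nat.div_eq_of_lt hj, Nat.mul_add_mod,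
        Nat.mod_eq_of_lt hj, Nat.add_zero]
  rw [arrayList, key]
  have e : ∀ {α : Type} (f : ℕ → α), (List.range n).map f = 
      (List.finRange n).map fun i : Fin n => f i := by
    intro α f
    rw [← List.map_coe_finRange_eq_range, List.map_map]
    rfl
  rw [List.flatMap_def, e, ← List.flatMap_def]
  simp only [e]

theorem filterMap_flatMap {α β γ : Type} (f : β → Option γ) (l : List α) (g : α → List β) :
    (l.flatMap g).filterMap f = l.flatMap fun a => (g a).filterMap f := by
  induction l with
  | nil => rfl
  | cons a l ih => simp [ih]

theorem rows_encodeGraph (G : SimpleGraph (Fin n)) (l : List Bool) :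
    rows ((encodeGraph ⟨n, G⟩).map Sum.inl ++ l.map Sum.inr) = n := by
  have h₁ : rows (l.map Sum.inr) = 0 := by induction l <;> simp_all
  have h₂ : ∀ (L : List Bool) (M : List (Option Bool)),
      rows ((L.map some ++ M).map Sum.inl) = rows (M.map Sum.inl) := by
    intro L M
    induction L <;> simp_all
  have h₃ : ∀ (L : List (Fin n)) (g : Fin n → List Bool),
      rows ((L.flatMap fun i => none :: (g i).map some).map Sum.inl) = L.length := by
    intro L g
    induction L with
    | nil => simp
    | cons i L ih =>
      rw [List.flatMap_cons, List.cons_append, List.map_cons, rows_none, h₂, ih, List.length_cons]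
  have h₄ := h₃ (List.finRange n) fun i => (List.finRange n).map fun j => by
    classical exact decide (G.Adj i j)
  simp only [List.map_map] at h₄
  rw [rows, List.count_append]
  refine (congrArg₂ _ h₄ h₁).trans ?_
  simp

theorem matrixPart_encodeGraph (G : SimpleGraph (Fin n)) (l : List Bool) :
    matrixPart ((encodeGraph ⟨n, G⟩).map Sum.inl ++ l.map Sum.inr) = arrayList n (matrix G) := by
  have h₁ : matrixPart (l.map Sum.inr) = [] := by induction l <;> simp_all
  have h₂ : matrixPart ((encodeGraph ⟨n, G⟩).map Sum.inl) = arrayList n (matrix G) := by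
    rw [arrayList_eq_flatMap, matrixPart, encodeGraph, List.filterMap_map, filterMap_flatMap]
    refine List.flatMap_congr fun i _ => ?_
    have h : ∀ L : List Bool, matrixPart ((L.map some).map Sum.inl) = L := by
      intro L
      induction L <;> simp_all
    have e : (List.finRange n).map (fun j : Fin n => matrix G i j) =
        (List.finRange n).map fun j : Fin n => by classical exact decide (G.Adj i j) := by
      refine List.map_congr_left fun j _ => ?_
      simp [matrix]
    rw [e, ← h ((List.finRange n).map _), matrixPart, List.filterMap_map, List.map_map]
    rfl
  rw [matrixPart, List.filterMap_append]
  exact (congrArg₂ _ h₂ h₁).trans (List.append_nil _)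

theorem numPart_encodeGraph (G : SimpleGraph (Fin n)) (l : List Bool) :
    numPart ((encodeGraph ⟨n, G⟩).map Sum.inl ++ l.map Sum.inr) = l := by
  have h₁ : numPart (l.map Sum.inr) = l := by induction l <;> simp_all
  have h₂ : ∀ l : List (Option Bool), numPart (l.map Sum.inl) = [] := by
    intro l
    induction l <;> simp_all
  rw [numPart, List.filterMap_append]
  exact congrArg₂ _ (h₂ _) h₁

theorem length_encodeGraph (G : SimpleGraph (Fin n)) : (encodeGraph ⟨n, G⟩).length = n * n + n := by
  simp [encodeGraph, List.length_flatMap, Nat.mul_add]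

/-- The memory after the algorithm. -/
noncomputable def solved (G : SimpleGraph (Fin n)) (l : List Bool) : Memory :=
  solve.eval n (fun _ => none) (initial (matrix G) l)

theorem arr_solved (l : List Bool) : (solved G l).arr .sol = solution G := by
  rw [solved, eval_solve rfl]
  rfl

theorem buf_solved (l : List Bool) : (solved G l).buf = (initial (matrix G) l).buf := by
  rw [solved, eval_solve rfl]
  rfl

theorem count_solution (G : SimpleGraph (Fin n)) :
    count n (fun w => solution G w w) = (solutionSet G).card :=
  (card_filter_fin _).symm

/-- Read the input and find a solution. -/
noncomputable def start : Prog Stack := prepare.seq solve.toProg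

/-- Shared by both machines: the search problem is the case `l = []`. The input has `n * n + n`
symbols for the graph alone, so bounds in `n` and `n * n` become bounds in its length. -/
theorem runs_start {I : Type} {d : I → Sym} {i : List I} {l : List Bool}
    (hi : i.map d = (encodeGraph ⟨n, G⟩).map Sum.inl ++ l.map Sum.inr) :
    ∃ r, Runs d start ⟨none, i, fun _ => []⟩ ⟨r, [], rep n (fun _ => none) (solved G l)⟩
      (13 * i.length + 6 + solve.time.eval i.length) := by
  have hl := congrArg List.length hi
  simp only [List.length_map, List.length_append, length_encodeGraph] at hl
  have h₁ := runs_prepare (d := d) (i := i) (n := n) (A := matrix G) (l := l)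
    (by rw [hi, rows_encodeGraph]) (by rw [hi, matrixPart_encodeGraph])
    (by rw [hi, numPart_encodeGraph])
  obtain ⟨r, h₂⟩ := Cmd.runs_toProg (d := d) (i := ([] : List I)) solve (valid_solve n)
    (initial (matrix G) l) none
  have := eval_mono solve.time (show n ≤ i.length by omega)
  exact ⟨r, (h₁.seq h₂).mono (by omega)⟩

theorem map_solution (G : SimpleGraph (Fin n)) :
    ((List.range n).map fun w => solution G w w) = encodeVertexSet ⟨n, solutionSet G⟩ := by
  rw [← List.map_coe_finRange_eq_range, List.map_map]
  refine List.map_congr_left fun w _ => ?_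
  simp [solutionSet]

/-- The search algorithm. -/
noncomputable def search : Prog Stack :=
  start.seq (emit.toProg.seq ((move (.buf .sel) (.buf .out)).seq (finish (.buf .out))))

open Polynomial in
/-- The running time of the search algorithm. -/
noncomputable def searchTime : ℕ[X] :=
  (13 * X + 6 + solve.time) + (emit.time + ((3 * X + 2) + (C (Fintype.card (Cell Index Table Buffer)) * (3 * X + 2) + 1)))

theorem runs_search (G : SimpleGraph (Fin n)) :
    ∃ r, Runs Sum.inl search ⟨none, encodeGraph ⟨n, G⟩, fun _ => []⟩
      ⟨r, [], update (fun _ => []) (.buf .out) (encodeVertexSet ⟨n, solutionSet G⟩)⟩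
      (searchTime.eval (encodeGraph ⟨n, G⟩).length) := by
  have hlen := length_encodeGraph G
  obtain ⟨r₁, h₁⟩ := runs_start (G := G) (d := Sum.inl) (i := encodeGraph ⟨n, G⟩) (l := [])
    (by simp)
  obtain ⟨r₂, h₂⟩ := Cmd.runs_toProg (d := Sum.inl) (i := ([] : List (Option Bool))) emit
    (valid_emit n) (solved G []) r₁
  rw [eval_emit, arr_solved, buf_solved, map_solution] at h₂
  have hL : (encodeVertexSet ⟨n, solutionSet G⟩).length = n := by simp [encodeVertexSet]
  generalize encodeVertexSet ⟨n, solutionSet G⟩ = L at h₂ hL ⊢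
  -- `emit` leaves the bits in reverse order, which this move corrects.
  have h₃ := runs_move (d := Sum.inl) (a := .buf Buffer.sel) (b := .buf Buffer.out) (by simp) r₂
    ([] : List (Option Bool)) (rep n (fun _ : Index => none)
      ((solved G []).setBuf .sel (L.reverse ++ (initial (matrix G) []).buf .sel)))
  obtain ⟨r₄, h₄⟩ := runs_finish (d := Sum.inl) (.buf Buffer.out) (B := n * n + n)
    (S := update (update (rep n (fun _ : Index => none) ((solved G []).setBuf .sel
      (L.reverse ++ (initial (matrix G) []).buf .sel))) (.buf .sel) []) (.buf .out)
      ((rep n (fun _ : Index => none) ((solved G []).setBuf .sel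
        (L.reverse ++ (initial (matrix G) []).buf .sel)) (.buf .sel)).reverse ++
        rep n (fun _ : Index => none) ((solved G []).setBuf .sel
        (L.reverse ++ (initial (matrix G) []).buf .sel)) (.buf .out))) (by
      intro c
      rcases c with _ | x | x | a | z | j
      · simp [rep]
      · simp [rep]
      · simp [rep]
      · simp [rep]
      · cases z <;> simp [rep, Mem.setBuf, initial, buf_solved, hL]
      · simp [rep]) none ([] : List (Option Bool))
  refine ⟨r₄, ((h₁.seq (h₂.seq (h₃.seq h₄))).of_eq rfl ?_).mono ?_⟩
  · simp [rep, Mem.setBuf, initial, buf_solved]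
  · have := eval_mono emit.time (show n ≤ (encodeGraph ⟨n, G⟩).length by omega)
    have e : (rep n (fun _ : Index => none) ((solved G []).setBuf .sel
        (L.reverse ++ (initial (matrix G) []).buf .sel)) (.buf .sel)).length = n := by
      simp [rep, Mem.setBuf, initial, hL]
    rw [e, hlen]
    rw [hlen] at this
    simp only [searchTime, Polynomial.eval_add, Polynomial.eval_mul, Polynomial.eval_ofNat,
      Polynomial.eval_X, Polynomial.eval_C, Polynomial.eval_one]
    omega

theorem solvableInPolyTime : SolvableInPolyTime chordal coChain :=
  ⟨fun G => solutionSet G.1.2, fun G => isMinimumDeletionSet_solutionSet G.2,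
    computableInPolyTime Sum.inl search (.buf .out) searchTime fun G => runs_search G.1.2⟩

/-- The decision algorithm. -/
noncomputable def decideBound : Prog Stack :=
  start.seq ((countSol .tally).toProg.seq ((compare (.buf .num) (.buf .tally) (.buf .half)).seq
    ((seq (pop (.buf .tally)) (ite Option.isSome (push (.buf .out) fun _ => false)
      (push (.buf .out) fun _ => true))).seq (finish (.buf .out)))))

open Polynomial in
/-- The running time of the decision algorithm. -/
noncomputable def decideTime : ℕ[X] :=
  (13 * X + 6 + solve.time) + ((countSol .tally).time + (((7 * X + 8) * X + 2) +
    (3 + (C (Fintype.card (Cell Index Table Buffer)) * (3 * (X + 1) + 2) + 1))))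

/-- The tally holds the size of the optimum in unary; after the comparison it is empty exactly when
that size is at most `k`, and a single pop tests this. -/
theorem runs_decideBound (G : SimpleGraph (Fin n)) (k : ℕ) :
    ∃ r, Runs id decideBound ⟨none, encodeGraphNat (⟨n, G⟩, k), fun _ => []⟩
      ⟨r, [], update (fun _ => []) (.buf .out) [decide ((solutionSet G).card ≤ k)]⟩
      (decideTime.eval (encodeGraphNat (⟨n, G⟩, k)).length) := by
  have hlen : (encodeGraphNat (⟨n, G⟩, k)).length =
      n * n + n + (Computability.encodeNat k).length := by
    simp [encodeGraphNat, length_encodeGraph]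
  obtain ⟨r₁, h₁⟩ := runs_start (G := G) (d := id) (i := encodeGraphNat (⟨n, G⟩, k))
    (l := Computability.encodeNat k) (by simp [encodeGraphNat])
  have hk := reduce_eq_zero_iff (Computability.encodeNat k) (solutionSet G).card
  have hle := reduce_le (Computability.encodeNat k) (solutionSet G).card
  rw [value_encodeNat] at hk
  generalize encodeGraphNat (⟨n, G⟩, k) = i at h₁ hlen ⊢
  generalize Computability.encodeNat k = l at h₁ hlen hk hle
  obtain ⟨r₂, h₂⟩ := Cmd.runs_toProg (d := id) (i := ([] : List Sym)) (countSol .tally)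
    (valid_countSol n .tally) (solved G l) r₁
  have hcard : (solutionSet G).card ≤ n := (Finset.card_le_univ _).trans (by simp)
  rw [eval_countSol, arr_solved, buf_solved, count_solution] at h₂
  generalize (solutionSet G).card = s at h₂ hk hcard hle ⊢
  let S := rep n (fun _ : Index => none)
    ((solved G l).setBuf .tally (List.replicate s true ++ (initial (matrix G) l).buf .tally))
  have hnum : S (.buf .num) = l := by simp [S, rep, Mem.setBuf, buf_solved, initial]
  have h₃ := runs_compare (d := id) (S := S) (l := .buf .num) (a := .buf .tally) (b := .buf .half)
    (t := s) (by simp) (by simp) (by simp) (by simp [S, rep, Mem.setBuf, initial])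
    (by simp [S, rep, Mem.setBuf, buf_solved, initial]) r₂ []
  rw [hnum] at h₃
  have h₄ : ∃ r S', Runs id (seq (pop (.buf .tally)) (ite Option.isSome
      (push (.buf .out) fun _ => false) (push (.buf .out) fun _ => true)))
      ⟨none, [], update (update S (.buf .num) []) (.buf .tally)
        (List.replicate (reduce l s) true)⟩ ⟨r, [], S'⟩ 3 ∧
      S' (.buf .out) = [decide (s ≤ k)] ∧ ∀ c, (S' c).length ≤ n * n + n + 1 := by
    -- The added 1 makes room for the answer bit when `n = 0`.
    have hbound : ∀ b : Bool, ∀ c, (update (update (update (update S (.buf .num) []) (.buf .tally)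
        (List.replicate (reduce l s) true)) (.buf .tally)
        (List.replicate (reduce l s) true).tail) (.buf .out) [b] c).length ≤ n * n + n + 1 := by
      intro b c
      rcases c with _ | x | x | a | z | j
      · simp [S, rep]
        omega
      · simp [S, rep]
      · simp [S, rep]
      · simp [S, rep, add_assoc]
      · cases z <;> simp [S, rep, Mem.setBuf, initial, buf_solved]
        omega
      · simp [S, rep]
    by_cases h0 : reduce l s = 0
    · refine ⟨_, _, (((runs_pop _ _ _ _).seq ((runs_push _ _ _ _ _).ite_false ?_)).of_eq rfl
        rfl).mono (by simp), ?_, ?_⟩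
      · simp [h0]
      · simp [S, rep, Mem.setBuf, initial, buf_solved, hk.1 h0]
      · simpa [S, rep, Mem.setBuf, initial, buf_solved] using hbound true
    · refine ⟨_, _, (((runs_pop _ _ _ _).seq ((runs_push _ _ _ _ _).ite_true ?_)).of_eq rfl
        rfl).mono (by simp), ?_, ?_⟩
      · obtain ⟨u, hu⟩ := Nat.exists_eq_succ_of_ne_zero h0
        simp [hu, List.replicate_succ]
      · simpa [S, rep, Mem.setBuf, initial, buf_solved] using mt hk.2 h0
      · simpa [S, rep, Mem.setBuf, initial, buf_solved] using hbound false
  obtain ⟨r₄, S', h₄, hout, hS'⟩ := h₄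
  obtain ⟨r₅, h₅⟩ := runs_finish (d := id) (.buf Buffer.out) hS' r₄ ([] : List Sym)
  rw [hout] at h₅
  refine ⟨r₅, (h₁.seq (h₂.seq (h₃.seq (h₄.seq h₅)))).mono ?_⟩
  have hi : n ≤ i.length := by omega
  have h₆ := eval_mono (countSol .tally).time hi
  have h₇ : (7 * s + 8) * l.length ≤ (7 * i.length + 8) * i.length :=
    Nat.mul_le_mul (by omega) (by omega)
  have h₈ : Fintype.card (Cell Index Table Buffer) * (3 * (n * n + n + 1) + 2) ≤
      Fintype.card (Cell Index Table Buffer) * (3 * (i.length + 1) + 2) := Nat.mul_le_mul_left _ (by omega)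
  simp only [decideTime, Polynomial.eval_add, Polynomial.eval_mul, Polynomial.eval_ofNat,
    Polynomial.eval_X, Polynomial.eval_C, Polynomial.eval_one]
  omega

theorem decidableInPolyTime : DecidableInPolyTime chordal coChain := by
  refine computableInPolyTime id decideBound (.buf .out) decideTime fun p => ?_
  have h : (∃ X : Finset (Fin p.1.1.1), X.card ≤ p.2 ∧ IsDeletionSet coChain p.1.1.2 X) ↔
      (solutionSet p.1.1.2).card ≤ p.2 := by
    obtain ⟨h₁, h₂⟩ := isMinimumDeletionSet_solutionSet p.1.2
    exact ⟨fun ⟨X, hX, h⟩ => (h₂ X h).trans hX, fun h => ⟨_, h, h₁⟩⟩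
  simp only [h]
  exact runs_decideBound p.1.1.2 p.2

end VertexDeletion

theorem mainTheorem7 : VertexDeletion.InP VertexDeletion.chordal VertexDeletion.coChain :=
  ⟨VertexDeletion.solvableInPolyTime, VertexDeletion.decidableInPolyTime⟩
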